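/- A real $n\times n$ matrix is SDDM if it is symmetric, nonsingular, has non-positive off-diagonal entries, and each diagonal entry is at least the sum of the absolute values of the other entries in its row. For symmetric matrices write $A \approx_\epsilon B$ if both $e^{\epsilon}B - A$ and $A - e^{-\epsilon}B$ are positive semidefinite. There is an absolute constant $C$ such that for every $n$ and every $n\times n$ SDDM matrix $M$ there are an ordering of the indices (a permutation matrix $P$), a diagonal matrix $D$ and an upper-triangular matrix $U$ with at most $Cn$ nonzero entries such that $$U^{T} D U \approx_2 P^{T} M P .$$ Moreover, back solves ($Ux=b$ for arbitrary $b$) and forward solves ($U^{T}x=b$ for arbitrary $b$) can each be performed with work at most $Cn$ and depth at most $C\log^2 n$: for each of the two there is an arithmetic circuit, with inputs the entries of $U$ and of $b$, with at most $Cn$ gates of fan-in two from $\{+,-,\times,/\}$ and depth at most $C\log^2 n$, that outputs the solution $x$ for every $b$ without ever dividing by zero. -/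

import Mathlib

open scoped Matrix

/-- SDDM matrices: symmetric, diagonally dominant, non-positive off-diagonal entries,
nonsingular. -/
structure IsSDDM {n : ℕ} (M : Matrix (Fin n) (Fin n) ℝ) : Prop where
  symm : M.IsSymm
  diagDominant : ∀ i, ∑ j ∈ Finset.univ.erase i, |M i j| ≤ M i i
  offDiag_nonpos : ∀ i j, i ≠ j → M i j ≤ 0
  nonsingular : IsUnit M.det

/-- `A ≈_ε B`, that is `e^ε B ≽ A ≽ e^{-ε} B` in the Loewner order. -/
def SpectralApprox {n : ℕ} (ε : ℝ) (A B : Matrix (Fin n) (Fin n) ℝ) : Prop :=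
  (Real.exp ε • B - A).PosSemidef ∧ (A - Real.exp (-ε) • B).PosSemidef

/-- The number of nonzero entries of a matrix. -/
noncomputable def numNonzero {n : ℕ} (A : Matrix (Fin n) (Fin n) ℝ) : ℕ :=
  {p : Fin n × Fin n | A p.1 p.2 ≠ 0}.ncard

/-- The binary arithmetic operations; each costs one unit of work and one unit of depth. -/
inductive ArithOp where
  | add
  | sub
  | mul
  | div

/-- The value of an operation on two reals. -/
noncomputable def ArithOp.apply : ArithOp → ℝ → ℝ → ℝ
  | .add, a, b => a + b
  | .sub, a, b => a - b
  | .mul, a, b => a * b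
  | .div, a, b => a / b

/-- Arithmetic circuits with `s` gates of fan-in two over the inputs `ι`, without constants:
every new gate reads two wires, each of which is an input or one of the gates present
before it. The work of the circuit is its number `s` of gates. -/
inductive ArithCircuit (ι : Type) : ℕ → Type where
  | nil : ArithCircuit ι 0
  | snoc {s : ℕ} (c : ArithCircuit ι s) (op : ArithOp) (l r : ι ⊕ Fin s) :
      ArithCircuit ι (s + 1)

namespace ArithCircuit

/-- The values at the gates, for the input values `x`. -/
noncomputable def gateValue {ι : Type} (x : ι → ℝ) :
    {s : ℕ} → ArithCircuit ι s → Fin s → ℝ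
  | _, nil => Fin.elim0
  | _, snoc c op l r =>
      Fin.snoc (α := fun _ => ℝ) (gateValue x c)
        (op.apply (Sum.elim x (gateValue x c) l) (Sum.elim x (gateValue x c) r))

/-- The value at a wire, which is an input or a gate. -/
noncomputable def value {ι : Type} {s : ℕ} (c : ArithCircuit ι s) (x : ι → ℝ)
    (w : ι ⊕ Fin s) : ℝ :=
  Sum.elim x (c.gateValue x) w

/-- No division gate divides by zero on the input values `x`. -/
def DivSafe {ι : Type} (x : ι → ℝ) : {s : ℕ} → ArithCircuit ι s → Prop
  | _, nil => True
  | _, snoc c op _ r => DivSafe x c ∧ (op = ArithOp.div → c.value x r ≠ 0)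

/-- The depth of each gate: the largest number of gates on a directed path ending there. -/
def gateDepth {ι : Type} : {s : ℕ} → ArithCircuit ι s → Fin s → ℕ
  | _, nil => Fin.elim0
  | _, snoc c _ l r =>
      Fin.snoc (α := fun _ => ℕ) (gateDepth c)
        (max (Sum.elim (fun _ => 0) (gateDepth c) l)
          (Sum.elim (fun _ => 0) (gateDepth c) r) + 1)

/-- The depth of the circuit: the largest number of gates on a directed path. -/
def depth {ι : Type} {s : ℕ} (c : ArithCircuit ι s) : ℕ :=
  Finset.univ.sup c.gateDepth

end ArithCircuit

/-- Linear systems in `A` can be solved with the given work and depth: some arithmetic circuit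
within these bounds, whose inputs are the entries of `A` and those of the right-hand side `b`,
outputs a solution `x` of `A x = b` for every `b`, never dividing by zero. -/
def SolvableIn {n : ℕ} (A : Matrix (Fin n) (Fin n) ℝ) (work depth : ℝ) : Prop :=
  ∃ (s : ℕ) (c : ArithCircuit ((Fin n × Fin n) ⊕ Fin n) s)
    (out : Fin n → ((Fin n × Fin n) ⊕ Fin n) ⊕ Fin s),
    (s : ℝ) ≤ work ∧ (c.depth : ℝ) ≤ depth ∧
      ∀ b : Fin n → ℝ,
        c.DivSafe (Sum.elim (fun p => A p.1 p.2) b) ∧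
          A *ᵥ (fun i => c.value (Sum.elim (fun p => A p.1 p.2) b) (out i)) = b

set_option linter.unusedSectionVars false

/-! ### Linear-sized spectral sparsification by barrier potentials. -/

section Sparsification

open Matrix

variable {V : Type*} [Fintype V] [DecidableEq V]

/-! The factorization is a block Gaussian elimination that removes a constant fraction of the
vertices at a time and approximates each step by a sparse one. An SDDM matrix is a sum of rank-one
edge and vertex terms. The Batson–Spielman–Srivastava barrier argument (`Barrier.step`,
`exists_sparsifier`) reweights linearly many of them into a spectrally close sparse SDDM matrix
(`IsSDDMOn.exists_sparse`). Half of its vertices have bounded degree, and a 5-coloring with little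
monochromatic weight leaves among these a set `F` of at least a tenth of all vertices whose
principal block `A` is strongly dominant (`IsSDDMOn.exists_dominant_subset`).

Exact elimination of `F` would need `A⁻¹ * B`, which may be dense. Split `A = X + L` into the
diagonal `X` of row sums and a Laplacian `L`. Strong dominance gives `L ≤ X / 2`, so Jacobi iterates
converge geometrically to `A⁻¹ * B` and stay sparse (`StronglyDominant.jacobi_error`,
`jacobi_row_ncard`). Their error is controlled by the Schur complement alone, and `X ≤ A ≤ 3/2 X`
lets `X` serve as the pivot block (`StronglyDominant.block_elimination`). The Schur complement is
again SDDM, on at most nine tenths of the vertices, and the construction recurses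
(`exists_levelFactorization`).

The errors must not accumulate. Step `j` loses a factor `exp (1 / ((j + 1) * (j + 2)))`, which
telescopes to at most `e` in total. This accuracy costs `exp (O (log² j))` nonzeros per row, and the
geometric decay of the sizes keeps the sum linear in `n`. The pivot factor `3/2` concerns a
different block at each step and is paid once; since `3/2 < e`, the overall quality is `e²`.

Each eliminated set is one level of `U`: its rows meet only their diagonal and later levels. There
are `O(log n)` levels, each solved in depth `O(log n)` by balanced sums, with two gates per
off-diagonal nonzero (`solvableIn_of_levels`). -/

theorem Matrix.IsSymm.dotProduct_mulVec_comm {P : Matrix V V ℝ} (hP : Pᵀ = P) (x y : V → ℝ) :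
    x ⬝ᵥ P *ᵥ y = y ⬝ᵥ P *ᵥ x := by
  rw [dotProduct_comm, dotProduct_mulVec, ← mulVec_transpose, hP]

theorem Matrix.PosSemidef.transpose_eq {P : Matrix V V ℝ} (hP : P.PosSemidef) : Pᵀ = P :=
  hP.1

theorem Matrix.PosSemidef.quad_nonneg {P : Matrix V V ℝ} (hP : P.PosSemidef) (x : V → ℝ) :
    0 ≤ x ⬝ᵥ P *ᵥ x := by
  simpa using hP.dotProduct_mulVec_nonneg x

theorem Matrix.PosDef.quad_pos {P : Matrix V V ℝ} (hP : P.PosDef) {x : V → ℝ} (hx : x ≠ 0) :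
    0 < x ⬝ᵥ P *ᵥ x := by
  simpa using hP.dotProduct_mulVec_pos hx

theorem posSemidef_of_quad {P : Matrix V V ℝ} (hP : Pᵀ = P) (h : ∀ x, 0 ≤ x ⬝ᵥ P *ᵥ x) :
    P.PosSemidef :=
  .of_dotProduct_mulVec_nonneg (by simpa [IsHermitian] using hP) (by simpa using h)

theorem posDef_of_quad {P : Matrix V V ℝ} (hP : Pᵀ = P)
    (h : ∀ x, x ≠ 0 → 0 < x ⬝ᵥ P *ᵥ x) : P.PosDef :=
  .of_dotProduct_mulVec_pos (by simpa [IsHermitian] using hP) (by simpa using h)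

open scoped MatrixOrder Matrix.Norms.L2Operator in
theorem posSemidef_eq_star_mul_self {Q : Matrix V V ℝ} (hQ : Q.PosSemidef) :
    ∃ B : Matrix V V ℝ, Q = star B * B :=
  CStarAlgebra.nonneg_iff_eq_star_mul_self.mp hQ.nonneg

/-- The Cauchy–Schwarz inequality for a positive semidefinite form. -/
theorem Matrix.PosSemidef.cauchy_schwarz {P : Matrix V V ℝ} (hP : P.PosSemidef) (x y : V → ℝ) :
    (x ⬝ᵥ P *ᵥ y) ^ 2 ≤ (x ⬝ᵥ P *ᵥ x) * (y ⬝ᵥ P *ᵥ y) := by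
  have h : ∀ t : ℝ, 0 ≤ (y ⬝ᵥ P *ᵥ y) * (t * t) + (2 * (x ⬝ᵥ P *ᵥ y)) * t + x ⬝ᵥ P *ᵥ x := by
    intro t
    have := hP.quad_nonneg (x + t • y)
    simp only [mulVec_add, mulVec_smul, dotProduct_add, add_dotProduct, dotProduct_smul,
      smul_dotProduct, smul_eq_mul] at this
    rw [IsSymm.dotProduct_mulVec_comm hP.transpose_eq y x] at this
    linarith
  have := discrim_le_zero h
  unfold discrim at this
  nlinarith

/-- Factor `Q = Bᵀ B` and apply Cauchy–Schwarz to each row of `B`; the squared row norms add up to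
the trace. -/
theorem Matrix.PosSemidef.quad_le_trace_mul {Q : Matrix V V ℝ} (hQ : Q.PosSemidef) (x : V → ℝ) :
    x ⬝ᵥ Q *ᵥ x ≤ Q.trace * (x ⬝ᵥ x) := by
  obtain ⟨B, rfl⟩ := posSemidef_eq_star_mul_self hQ
  have h1 : x ⬝ᵥ (star B * B) *ᵥ x = ∑ i, (B i ⬝ᵥ x) ^ 2 := by
    rw [← mulVec_mulVec, dotProduct_mulVec, star_eq_conjTranspose,
      conjTranspose_eq_transpose_of_trivial, vecMul_transpose]
    simp [dotProduct, mulVec, sq]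
  have h2 : (star B * B).trace = ∑ i, B i ⬝ᵥ B i := by
    simp only [trace, star_eq_conjTranspose, conjTranspose_eq_transpose_of_trivial, diag_apply,
      mul_apply, transpose_apply, dotProduct]
    rw [Finset.sum_comm]
  rw [h1, h2, Finset.sum_mul]
  refine Finset.sum_le_sum fun i _ => ?_
  have := Finset.sum_mul_sq_le_sq_mul_sq Finset.univ (B i) x
  simpa [dotProduct, sq] using this

theorem Matrix.PosDef.inv_mul {P : Matrix V V ℝ} (hP : P.PosDef) : P⁻¹ * P = 1 :=
  nonsing_inv_mul _ ((isUnit_iff_isUnit_det _).1 hP.isUnit)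

theorem Matrix.PosDef.mul_inv {P : Matrix V V ℝ} (hP : P.PosDef) : P * P⁻¹ = 1 :=
  mul_nonsing_inv _ ((isUnit_iff_isUnit_det _).1 hP.isUnit)

theorem Matrix.PosDef.dotProduct_sq_le {P : Matrix V V ℝ} (hP : P.PosDef) (v x : V → ℝ) :
    (v ⬝ᵥ x) ^ 2 ≤ (v ⬝ᵥ P⁻¹ *ᵥ v) * (x ⬝ᵥ P *ᵥ x) := by
  have h := hP.posSemidef.cauchy_schwarz (P⁻¹ *ᵥ v) x
  have e1 : (P⁻¹ *ᵥ v) ⬝ᵥ P *ᵥ x = v ⬝ᵥ x := by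
    rw [IsSymm.dotProduct_mulVec_comm hP.posSemidef.transpose_eq, mulVec_mulVec, hP.mul_inv, one_mulVec,
      dotProduct_comm]
  have e2 : (P⁻¹ *ᵥ v) ⬝ᵥ P *ᵥ (P⁻¹ *ᵥ v) = v ⬝ᵥ P⁻¹ *ᵥ v := by
    rw [mulVec_mulVec, hP.mul_inv, one_mulVec, dotProduct_comm]
  rwa [e1, e2] at h

theorem quad_vecMulVec (v x : V → ℝ) : x ⬝ᵥ vecMulVec v v *ᵥ x = (v ⬝ᵥ x) ^ 2 := by
  simp [vecMulVec_mulVec, dotProduct_comm x v, sq]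

theorem vecMulVec_self_transpose (v : V → ℝ) : (vecMulVec v v)ᵀ = vecMulVec v v := by
  simp [transpose_vecMulVec]

theorem Matrix.PosDef.sub_vecMulVec {P : Matrix V V ℝ} (hP : P.PosDef) {t : ℝ} (ht : 0 ≤ t)
    {v : V → ℝ} (h : t * (v ⬝ᵥ P⁻¹ *ᵥ v) < 1) : (P - t • vecMulVec v v).PosDef := by
  refine posDef_of_quad ?_ fun x hx => ?_
  · rw [transpose_sub, transpose_smul, vecMulVec_self_transpose, hP.posSemidef.transpose_eq]
  · have h1 := hP.quad_pos hx
    have h2 := mul_le_mul_of_nonneg_left (hP.dotProduct_sq_le v x) ht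
    simp only [sub_mulVec, smul_mulVec, dotProduct_sub, dotProduct_smul, quad_vecMulVec,
      smul_eq_mul]
    nlinarith

theorem Matrix.PosDef.add_vecMulVec {P : Matrix V V ℝ} (hP : P.PosDef) {t : ℝ} (ht : 0 ≤ t)
    (v : V → ℝ) : (P + t • vecMulVec v v).PosDef := by
  refine posDef_of_quad ?_ fun x hx => ?_
  · rw [transpose_add, transpose_smul, vecMulVec_self_transpose, hP.posSemidef.transpose_eq]
  · have h1 := hP.quad_pos hx
    simp only [add_mulVec, smul_mulVec, dotProduct_add, dotProduct_smul, quad_vecMulVec,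
      smul_eq_mul]
    positivity

/-- The trace of `P⁻¹` dominates its largest eigenvalue, so all eigenvalues of `P` exceed 1. This
lets the lower barrier advance by 1. -/
theorem Matrix.PosDef.sub_one {P : Matrix V V ℝ} (hP : P.PosDef) (h : P⁻¹.trace < 1) :
    (P - 1).PosDef := by
  refine posDef_of_quad ?_ fun x hx => ?_
  · rw [transpose_sub, hP.posSemidef.transpose_eq, transpose_one]
  · have h1 := hP.quad_pos hx
    have h2 := hP.dotProduct_sq_le x x
    have h3 := hP.inv.posSemidef.quad_le_trace_mul x
    have h4 : 0 < x ⬝ᵥ x := by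
      have := (PosDef.one (n := V) (R := ℝ)).quad_pos hx
      simpa using this
    simp only [sub_mulVec, one_mulVec, dotProduct_sub]
    have h5 : (x ⬝ᵥ x) ^ 2 ≤ P⁻¹.trace * (x ⬝ᵥ x) * (x ⬝ᵥ P *ᵥ x) :=
      h2.trans (mul_le_mul_of_nonneg_right h3 h1.le)
    have h6 : (x ⬝ᵥ x) ≤ P⁻¹.trace * (x ⬝ᵥ P *ᵥ x) := by
      by_contra hc
      push Not at hc
      nlinarith
    nlinarith

/-- The Sherman–Morrison formula, for traces. -/
theorem Matrix.PosDef.trace_inv_add_vecMulVec {P : Matrix V V ℝ} (hP : P.PosDef) (c : ℝ)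
    (v : V → ℝ) (h : 1 + c * (v ⬝ᵥ P⁻¹ *ᵥ v) ≠ 0) :
    (P + c • vecMulVec v v)⁻¹.trace =
      P⁻¹.trace - c * (v ⬝ᵥ (P⁻¹ * P⁻¹) *ᵥ v) / (1 + c * (v ⬝ᵥ P⁻¹ *ᵥ v)) := by
  have hs : (P⁻¹)ᵀ = P⁻¹ := hP.inv.posSemidef.transpose_eq
  have hv : v ᵥ* P⁻¹ = P⁻¹ *ᵥ v := by rw [← mulVec_transpose, hs]
  set d := 1 + c * (v ⬝ᵥ P⁻¹ *ᵥ v) with hd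
  have key : (P + c • vecMulVec v v)⁻¹ = P⁻¹ - (c / d) • vecMulVec (P⁻¹ *ᵥ v) (P⁻¹ *ᵥ v) := by
    apply inv_eq_right_inv
    rw [add_mul, mul_sub, mul_sub, hP.mul_inv, mul_smul_comm, mul_vecMulVec, mulVec_mulVec,
      hP.mul_inv, one_mulVec, smul_mul_assoc, vecMulVec_mul, hv, smul_mul_smul_comm,
      vecMulVec_mul_vecMulVec, ← sub_eq_zero]
    have : (1 : Matrix V V ℝ) - (c / d) • vecMulVec v (P⁻¹ *ᵥ v) + (c • vecMulVec v (P⁻¹ *ᵥ v) -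
        (c * (c / d)) • vecMulVec v ((v ⬝ᵥ P⁻¹ *ᵥ v) • (P⁻¹ *ᵥ v))) - 1 =
        (c - c / d * (1 + c * (v ⬝ᵥ P⁻¹ *ᵥ v))) • vecMulVec v (P⁻¹ *ᵥ v) := by
      rw [vecMulVec_smul]
      module
    rw [this, ← hd, div_mul_cancel₀ _ h, sub_self, zero_smul]
  rw [key, trace_sub, trace_smul, trace_vecMulVec, ← mulVec_mulVec,
    dotProduct_mulVec v, hv, smul_eq_mul]
  ring

theorem sum_quad_eq_trace {ι : Type*} [Fintype ι] {v : ι → V → ℝ}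
    (hv : ∑ i, vecMulVec (v i) (v i) = 1) (N : Matrix V V ℝ) :
    ∑ i, v i ⬝ᵥ N *ᵥ v i = N.trace := by
  calc ∑ i, v i ⬝ᵥ N *ᵥ v i = ∑ i, (N * vecMulVec (v i) (v i)).trace := by
        refine Finset.sum_congr rfl fun i _ => ?_
        rw [mul_vecMulVec, trace_vecMulVec, dotProduct_comm]
    _ = N.trace := by rw [← trace_sum, ← Finset.mul_sum, hv, mul_one]

theorem Matrix.PosDef.trace_sq_pos [Nonempty V] {Q : Matrix V V ℝ} (hQ : Q.PosDef) :
    0 < (Q * Q).trace := by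
  have h : (Qᴴ * 1 * Q).PosDef := PosDef.one.conjTranspose_mul_mul_same
    (mulVec_injective_iff_isUnit.2 hQ.isUnit)
  rw [hQ.1, mul_one] at h
  exact h.trace_pos

theorem Matrix.PosSemidef.trace_mul_mul_nonneg {Q N : Matrix V V ℝ} (hQ : Q.PosSemidef)
    (hN : Nᵀ = N) : 0 ≤ (N * Q * N).trace := by
  have h := hQ.conjTranspose_mul_mul_same N
  rw [conjTranspose_eq_transpose_of_trivial, hN] at h
  exact h.trace_nonneg

theorem inv_sub_inv_shift {P₀ P : Matrix V V ℝ} (h₀ : P₀.PosDef) (h : P.PosDef) {δ : ℝ}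
    (hd : P - P₀ = δ • 1) : P₀⁻¹ - P⁻¹ = δ • (P₀⁻¹ * P⁻¹) := by
  have : P₀⁻¹ * (P - P₀) * P⁻¹ = P₀⁻¹ - P⁻¹ := by
    rw [mul_sub, sub_mul, mul_assoc, h.mul_inv, h₀.inv_mul, mul_one, one_mul]
  rw [← this, hd]
  simp

/-- By the resolvent identity the drop of the potential is `δ` times the trace of `P₀⁻¹ P⁻¹`; a
second use of the identity replaces `P₀⁻¹` by `P⁻¹` plus a term of nonnegative trace. -/
theorem upper_barrier_shift [Nonempty V] {P₀ P : Matrix V V ℝ} (h₀ : P₀.PosDef) (h : P.PosDef)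
    {δ : ℝ} (hδ : 0 < δ) (hd : P - P₀ = δ • 1) :
    δ * (P⁻¹ * P⁻¹).trace ≤ P₀⁻¹.trace - P⁻¹.trace := by
  have e := inv_sub_inv_shift h₀ h hd
  have e2 : P₀⁻¹ = P⁻¹ + δ • (P₀⁻¹ * P⁻¹) := by rw [← e]; abel
  have e3 : P₀⁻¹ * P⁻¹ = P⁻¹ * P⁻¹ + δ • (P₀⁻¹ * P⁻¹ * P⁻¹) := by
    conv_lhs => rw [e2]
    rw [add_mul, smul_mul_assoc]
  have e4 : (P₀⁻¹ * P⁻¹ * P⁻¹).trace = (P⁻¹ * P₀⁻¹ * P⁻¹).trace := by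
    rw [trace_mul_comm, ← mul_assoc]
  have h5 := h₀.inv.posSemidef.trace_mul_mul_nonneg h.inv.posSemidef.transpose_eq
  rw [← trace_sub, e, trace_smul, e3, trace_add, trace_smul, e4, smul_eq_mul, smul_eq_mul]
  nlinarith [mul_nonneg hδ.le h5]

/-- With `g` the increase of the potential, the resolvent identity gives `tr P⁻² = g + tr (P⁻¹ P₀⁻¹
P⁻¹)`, and Cauchy–Schwarz bounds the last trace below by `g² / tr P₀⁻¹ ≥ g²`. -/
theorem lower_barrier_shift [Nonempty V] {P₀ P : Matrix V V ℝ} (h₀ : P₀.PosDef) (h : P.PosDef)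
    (hd : P₀ - P = 1) (ht : P₀⁻¹.trace ≤ 1) :
    0 < P⁻¹.trace - P₀⁻¹.trace ∧
      (P⁻¹.trace - P₀⁻¹.trace) * (1 + (P⁻¹.trace - P₀⁻¹.trace)) ≤ (P⁻¹ * P⁻¹).trace := by
  have e := inv_sub_inv_shift h h₀ (δ := 1) (by simpa using hd)
  rw [one_smul] at e
  have e2 : P⁻¹ = P₀⁻¹ + P⁻¹ * P₀⁻¹ := by rw [← e]; abel
  have hc : P⁻¹ * P₀⁻¹ = P₀⁻¹ * P⁻¹ := by
    have := inv_sub_inv_shift h₀ h (δ := -1) (by rw [← neg_sub, hd]; simp)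
    rw [neg_one_smul, eq_neg_iff_add_eq_zero] at this
    rw [← e]
    rw [← sub_eq_zero, ← neg_eq_zero, ← this]; abel
  have e3 : P⁻¹ * P⁻¹ = P⁻¹ * P₀⁻¹ + P⁻¹ * P₀⁻¹ * P⁻¹ := by
    calc P⁻¹ * P⁻¹ = (P₀⁻¹ + P⁻¹ * P₀⁻¹) * P⁻¹ := by rw [← e2]
      _ = P⁻¹ * P₀⁻¹ + P⁻¹ * P₀⁻¹ * P⁻¹ := by rw [add_mul, ← hc]
  have hG : P⁻¹.trace - P₀⁻¹.trace = (P⁻¹ * P₀⁻¹).trace := by rw [← trace_sub, e]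
  have h0 : 0 < P₀⁻¹.trace := h₀.inv.trace_pos
  have hpos : 0 < (P⁻¹ * P₀⁻¹).trace := by
    have e4 : P⁻¹ * P₀⁻¹ = P₀⁻¹ * P₀⁻¹ + P₀⁻¹ * P⁻¹ * P₀⁻¹ := by
      conv_lhs => rw [e2]
      rw [add_mul, hc]
    rw [e4, trace_add]
    have := h.inv.posSemidef.trace_mul_mul_nonneg h₀.inv.posSemidef.transpose_eq
    have := h₀.inv.trace_sq_pos
    linarith
  rw [hG]
  refine ⟨hpos, ?_⟩
  set g := (P⁻¹ * P₀⁻¹).trace with hg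
  set τ := P₀⁻¹.trace with hτ
  -- Cauchy–Schwarz for the trace form of `P₀⁻¹`, with the optimal multiple `g / τ` of the identity
  -- subtracted.
  have h6 : 0 ≤ (P⁻¹ * P₀⁻¹ * P⁻¹).trace - 2 * (g / τ) * g + (g / τ) ^ 2 * τ := by
    have := h₀.inv.posSemidef.trace_mul_mul_nonneg (N := P⁻¹ - (g / τ) • 1)
      (by rw [transpose_sub, h.inv.posSemidef.transpose_eq]; simp)
    have e5 : (P⁻¹ - (g / τ) • 1) * P₀⁻¹ * (P⁻¹ - (g / τ) • 1) =
        P⁻¹ * P₀⁻¹ * P⁻¹ - (g / τ) • (P⁻¹ * P₀⁻¹) - (g / τ) • (P₀⁻¹ * P⁻¹) +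
          ((g / τ) ^ 2) • P₀⁻¹ := by
      simp only [sub_mul, mul_sub, smul_mul_assoc, mul_smul_comm, mul_one, one_mul, smul_sub]
      module
    rw [e5, ← hc, trace_add, trace_sub, trace_sub, trace_smul, trace_smul, ← hg, ← hτ] at this
    simp only [smul_eq_mul] at this
    linarith
  have h7 : g ^ 2 ≤ (P⁻¹ * P₀⁻¹ * P⁻¹).trace * τ := by
    have : (P⁻¹ * P₀⁻¹ * P⁻¹).trace - 2 * (g / τ) * g + (g / τ) ^ 2 * τ =
      ((P⁻¹ * P₀⁻¹ * P⁻¹).trace * τ - g ^ 2) / τ := by field_simp; ring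
    rw [this] at h6
    have := (le_div_iff₀ h0).1 h6
    linarith
  have h8 : 0 ≤ (P⁻¹ * P₀⁻¹ * P⁻¹).trace :=
    h₀.inv.posSemidef.trace_mul_mul_nonneg h.inv.posSemidef.transpose_eq
  rw [e3, trace_add, ← hg]
  nlinarith

/-- The state of the barrier argument: the eigenvalues of `A` lie between `l` and `u`, and both
barrier potentials are at most `η`. -/
structure Barrier (η l u : ℝ) (A : Matrix V V ℝ) : Prop where
  upper : (u • 1 - A).PosDef
  lower : (A - l • 1).PosDef
  upper_trace : (u • 1 - A)⁻¹.trace ≤ η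
  lower_trace : (A - l • 1)⁻¹.trace ≤ η

/-- Shifting both barriers changes the potentials by `gU` and `gL`. An averaging argument over the
vectors finds one whose addition, with a suitable weight, compensates for both changes. -/
theorem Barrier.step [Nonempty V] {ι : Type*} [Fintype ι] {v : ι → V → ℝ}
    (hv : ∑ i, vecMulVec (v i) (v i) = 1) {η l u : ℝ} {A : Matrix V V ℝ}
    (hη : η ≤ 1 / 10) (hA : Barrier η l u A) :
    ∃ (i : ι) (t : ℝ), 0 ≤ t ∧
      Barrier η (l + 1) (u + 1 / (1 - 3 * η)) (A + t • vecMulVec (v i) (v i)) := by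
  have hη0 : 0 < η := hA.upper.inv.trace_pos.trans_le hA.upper_trace
  set δ := 1 / (1 - 3 * η) with hδ
  have hδ0 : 0 < δ := by apply one_div_pos.2; linarith
  have eU : (u + δ) • 1 - A = (u • 1 - A) + δ • 1 := by module
  have eL : A - (l + 1) • 1 = (A - l • 1) - 1 := by module
  have hU : ((u + δ) • 1 - A).PosDef := by
    rw [eU]; exact hA.upper.add (PosDef.one.smul hδ0)
  have hL : (A - (l + 1) • 1).PosDef := by
    rw [eL]; exact hA.lower.sub_one (by linarith [hA.lower_trace])
  have hUs := upper_barrier_shift hA.upper hU hδ0 (by rw [eU]; abel)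
  obtain ⟨hLpos, hLs⟩ := lower_barrier_shift hA.lower hL (by rw [eL]; abel)
    (by linarith [hA.lower_trace])
  set Q := ((u + δ) • 1 - A)⁻¹ with hQ
  set R := (A - (l + 1) • 1)⁻¹ with hR
  set gU := (u • 1 - A)⁻¹.trace - Q.trace with hgU
  set gL := R.trace - (A - l • 1)⁻¹.trace with hgL
  have hgU0 : 0 < gU := (mul_pos hδ0 hU.inv.trace_sq_pos).trans_le hUs
  -- The left total is below `(1 - 3η) + η`, by the choice of `δ`; the right total is at least `1 -
  -- η`.
  have hsum : ∑ i, ((v i ⬝ᵥ (Q * Q) *ᵥ v i) / gU + v i ⬝ᵥ Q *ᵥ v i) <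
      ∑ i, ((v i ⬝ᵥ (R * R) *ᵥ v i) / gL - v i ⬝ᵥ R *ᵥ v i) := by
    rw [Finset.sum_add_distrib, Finset.sum_sub_distrib, ← Finset.sum_div, ← Finset.sum_div,
      sum_quad_eq_trace hv, sum_quad_eq_trace hv, sum_quad_eq_trace hv, sum_quad_eq_trace hv]
    have h1 : (Q * Q).trace / gU ≤ 1 - 3 * η := by
      rw [div_le_iff₀ hgU0]
      have : (1 - 3 * η) * (δ * (Q * Q).trace) = (Q * Q).trace := by
        rw [hδ]; field_simp [show (1 - 3 * η) ≠ 0 by linarith]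
      rw [← this]
      exact mul_le_mul_of_nonneg_left hUs (by linarith)
    have h2 : 1 + gL ≤ (R * R).trace / gL := by
      rw [le_div_iff₀ hLpos]; linarith
    have := hA.upper_trace
    have := hA.lower_trace
    linarith
  obtain ⟨i, -, hi⟩ := Finset.exists_lt_of_sum_lt hsum
  have hQv := hU.inv.posSemidef.quad_nonneg (v i)
  have hQQv : 0 ≤ v i ⬝ᵥ (Q * Q) *ᵥ v i := by
    have h := PosSemidef.one.conjTranspose_mul_mul_same Q
    rw [hU.inv.1, mul_one] at h
    exact h.quad_nonneg _
  have hRv := hL.inv.posSemidef.quad_nonneg (v i)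
  rw [← hQ] at hQv
  rw [← hR] at hRv
  set a := v i ⬝ᵥ (Q * Q) *ᵥ v i with ha
  set b := v i ⬝ᵥ Q *ᵥ v i with hb
  set c := v i ⬝ᵥ (R * R) *ᵥ v i with hc
  set d := v i ⬝ᵥ R *ᵥ v i with hd
  set w := c / gL - d with hw
  have hw0 : 0 < w := lt_of_le_of_lt (by positivity) hi
  have htb : 1 / w * b < 1 := by
    rw [one_div, inv_mul_lt_iff₀ hw0, mul_one]
    exact lt_of_le_of_lt (le_add_of_nonneg_left (by positivity)) hi
  -- With weight `1 / w`, Sherman–Morrison lowers the lower potential by exactly `gL` and raises the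
  -- upper one by `a / (w - b) ≤ gU`.
  refine ⟨i, 1 / w, by positivity, ?_, ?_, ?_, ?_⟩
  · rw [← sub_sub]
    exact hU.sub_vecMulVec (by positivity) htb
  · rw [add_sub_right_comm]
    exact hL.add_vecMulVec (by positivity) _
  · rw [← sub_sub, sub_eq_add_neg _ ((1 / w) • _), ← neg_smul,
      hU.trace_inv_add_vecMulVec _ _ (by rw [← hQ, ← hb]; linarith), ← hQ, ← ha, ← hb]
    have h1 : a / gU + b ≤ w := hi.le
    have h2 : a ≤ (w - b) * gU := by
      rw [← le_sub_iff_add_le, div_le_iff₀ hgU0] at h1; exact h1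
    have h3 : 0 < w - b := by
      rw [one_div, inv_mul_lt_iff₀ hw0, mul_one] at htb; linarith
    have h4 : -(1 / w) * a / (1 + -(1 / w) * b) = -(a / (w - b)) := by
      have : 1 + -(1 / w) * b = (w - b) / w := by field_simp; ring
      rw [this]; field_simp
    rw [h4]
    have h5 : a / (w - b) ≤ gU := by rw [div_le_iff₀ h3]; linarith
    have := hA.upper_trace
    linarith
  · rw [add_sub_right_comm, hL.trace_inv_add_vecMulVec _ _ (by rw [← hR, ← hd]; positivity),
      ← hR, ← hc, ← hd]
    have h4 : 1 / w * c / (1 + 1 / w * d) = gL := by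
      have h5 : w + d = c / gL := by rw [hw]; ring
      have h6 : 1 + 1 / w * d = (w + d) / w := by field_simp
      have h7 : c ≠ 0 := by
        rintro h
        rw [h, zero_div] at h5
        linarith
      rw [h6, h5]; field_simp
    rw [h4]
    have := hA.lower_trace
    linarith

theorem barrier_zero [Nonempty V] {η : ℝ} (hη : 0 < η) :
    Barrier η (-(Fintype.card V / η)) (Fintype.card V / η) (0 : Matrix V V ℝ) := by
  have hc : (0 : ℝ) < Fintype.card V := by exact_mod_cast Fintype.card_pos
  have h : ((Fintype.card V / η : ℝ) • (1 : Matrix V V ℝ)).PosDef :=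
    PosDef.one.smul (by positivity)
  have ht : ((Fintype.card V / η : ℝ) • (1 : Matrix V V ℝ))⁻¹.trace ≤ η := by
    have : ((Fintype.card V / η : ℝ) • (1 : Matrix V V ℝ))⁻¹ = (η / Fintype.card V : ℝ) • 1 := by
      apply inv_eq_right_inv
      rw [smul_mul_smul_comm, mul_one, div_mul_div_comm, mul_comm, div_self (by positivity),
        one_smul]
    rw [this, trace_smul, trace_one, smul_eq_mul, div_mul_cancel₀ _ hc.ne']
  exact ⟨by simpa using h, by simpa using h, by simpa using ht, by simpa using ht⟩

theorem exists_barrier [Nonempty V] {ι : Type*} [Fintype ι] {v : ι → V → ℝ}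
    (hv : ∑ i, vecMulVec (v i) (v i) = 1) {η : ℝ} (hη0 : 0 < η) (hη : η ≤ 1 / 10) (m : ℕ) :
    ∃ s : ι → ℝ, (∀ i, 0 ≤ s i) ∧ {i | s i ≠ 0}.ncard ≤ m ∧
      Barrier η (-(Fintype.card V / η) + m) (Fintype.card V / η + m * (1 / (1 - 3 * η)))
        (∑ i, s i • vecMulVec (v i) (v i)) := by
  classical
  induction m with
  | zero => exact ⟨0, by simp, by simp, by simpa using barrier_zero hη0⟩
  | succ m ih =>
    obtain ⟨s, hs0, hsm, hs⟩ := ih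
    obtain ⟨i, t, ht, h⟩ := hs.step hv hη
    refine ⟨s + Pi.single i t, ?_, ?_, ?_⟩
    · intro j
      by_cases hj : j = i
      · subst hj; simpa using add_nonneg (hs0 j) ht
      · simpa [hj] using hs0 j
    · have : {j | (s + Pi.single i t : ι → ℝ) j ≠ 0} ⊆ insert i {j | s j ≠ 0} := by
        intro j hj
        by_cases hji : j = i
        · simp [hji]
        · right
          simpa [hji] using hj
      exact (Set.ncard_le_ncard this (Set.toFinite _)).trans
        ((Set.ncard_insert_le _ _).trans (by omega))
    · have e : ∑ j, (s + Pi.single i t : ι → ℝ) j • vecMulVec (v j) (v j) =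
          ∑ j, s j • vecMulVec (v j) (v j) + t • vecMulVec (v i) (v i) := by
        simp only [Pi.add_apply, add_smul, Finset.sum_add_distrib]
        congr 1
        rw [Finset.sum_eq_single i] <;> simp +contextual
      rw [e]
      convert h using 1 <;> push_cast <;> ring

theorem quad_sum_smul_vecMulVec {ι : Type*} [Fintype ι] (s : ι → ℝ) (v : ι → V → ℝ) (x : V → ℝ) :
    x ⬝ᵥ (∑ i, s i • vecMulVec (v i) (v i)) *ᵥ x = ∑ i, s i * (v i ⬝ᵥ x) ^ 2 := by
  simp only [sum_mulVec, dotProduct_sum, smul_mulVec, dotProduct_smul, quad_vecMulVec, smul_eq_mul]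

/-- Linear-sized spectral sparsification of a decomposition of the identity into rank-one
matrices. -/
theorem exists_sparsifier_one {ι : Type*} [Fintype ι] {v : ι → V → ℝ}
    (hv : ∑ i, vecMulVec (v i) (v i) = 1) {q : ℕ} (hq : 10 ≤ q) :
    ∃ s : ι → ℝ, (∀ i, 0 ≤ s i) ∧ {i | s i ≠ 0}.ncard ≤ Fintype.card V * q ^ 2 ∧
      ∀ x : V → ℝ, x ⬝ᵥ x ≤ ∑ i, s i * (v i ⬝ᵥ x) ^ 2 ∧
        ∑ i, s i * (v i ⬝ᵥ x) ^ 2 ≤ (1 + 10 / q) * (x ⬝ᵥ x) := by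
  rcases isEmpty_or_nonempty V with hV | hV
  · exact ⟨0, by simp, by simp, fun x => by simp [dotProduct]⟩
  have hq' : (10 : ℝ) ≤ q := by exact_mod_cast hq
  have hc : (0 : ℝ) < Fintype.card V := by exact_mod_cast Fintype.card_pos
  -- After `N q²` steps the barriers stand at `N q (q - 1)` and `N q (1 + q² / (q - 3))`, whose
  -- ratio is at most `1 + 10 / q` for `q ≥ 10`.
  obtain ⟨s, hs0, hsm, hs⟩ := exists_barrier hv (η := 1 / q) (by positivity)
    (one_div_le_one_div_of_le (by norm_num) hq') (Fintype.card V * q ^ 2)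
  set N : ℝ := (Fintype.card V : ℝ) with hN
  have el : -(N / (1 / q)) + ((Fintype.card V * q ^ 2 : ℕ) : ℝ) = N * q * (q - 1) := by
    push_cast; rw [← hN]; field_simp; ring
  have eu : N / (1 / q) + ((Fintype.card V * q ^ 2 : ℕ) : ℝ) * (1 / (1 - 3 * (1 / q))) =
      N * q * (1 + q ^ 2 / (q - 3)) := by
    have h3 : (q : ℝ) - 3 ≠ 0 := by linarith
    have : 1 - 3 * (1 / (q : ℝ)) = (q - 3) / q := by field_simp
    push_cast; rw [← hN, this]; field_simp
  rw [el, eu] at hs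
  have hl0 : 0 < N * q * (q - 1) := mul_pos (by positivity) (by linarith)
  refine ⟨fun i => s i / (N * q * (q - 1)), fun i => div_nonneg (hs0 i) hl0.le, ?_, fun x => ?_⟩
  · have : {i | s i / (N * q * (q - 1)) ≠ 0} = {i | s i ≠ 0} := by
      ext i; simp only [Set.mem_ofPred_eq, ne_eq, div_eq_zero_iff, hl0.ne', or_false]
    rw [this]; exact hsm
  · have e : ∑ i, s i / (N * q * (q - 1)) * (v i ⬝ᵥ x) ^ 2 =
        (∑ i, s i * (v i ⬝ᵥ x) ^ 2) / (N * q * (q - 1)) := by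
      rw [Finset.sum_div]; exact Finset.sum_congr rfl fun i _ => by ring
    have h1 := hs.lower.posSemidef.quad_nonneg x
    have h2 := hs.upper.posSemidef.quad_nonneg x
    simp only [sub_mulVec, smul_mulVec, one_mulVec, dotProduct_sub, dotProduct_smul,
      quad_sum_smul_vecMulVec, smul_eq_mul] at h1 h2
    rw [e, le_div_iff₀ hl0, div_le_iff₀ hl0]
    have hx : 0 ≤ x ⬝ᵥ x := by
      simpa using (PosSemidef.one (n := V) (R := ℝ)).quad_nonneg x
    refine ⟨by linarith, ?_⟩
    have h3 : 1 + (q : ℝ) ^ 2 / (q - 3) ≤ (1 + 10 / q) * (q - 1) := by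
      have h3 : (0 : ℝ) < q - 3 := by linarith
      have e2 : (1 + 10 / (q : ℝ)) * (q - 1) = (q + 10) * (q - 1) / q := by field_simp
      have e3 : 1 + (q : ℝ) ^ 2 / (q - 3) = (q - 3 + q ^ 2) / (q - 3) := by field_simp
      rw [e2, e3, div_le_div_iff₀ h3 (by linarith)]
      nlinarith
    have h4 := mul_le_mul_of_nonneg_right (mul_le_mul_of_nonneg_left h3
      (show 0 ≤ N * q by positivity)) hx
    linarith

/-- Linear-sized spectral sparsification of a sum of rank-one matrices. -/
theorem exists_sparsifier {ι : Type*} [Fintype ι] {M : Matrix V V ℝ} (hM : M.PosDef)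
    {v : ι → V → ℝ} (hv : ∑ i, vecMulVec (v i) (v i) = M) {q : ℕ} (hq : 10 ≤ q) :
    ∃ s : ι → ℝ, (∀ i, 0 ≤ s i) ∧ {i | s i ≠ 0}.ncard ≤ Fintype.card V * q ^ 2 ∧
      ∀ x : V → ℝ, x ⬝ᵥ M *ᵥ x ≤ ∑ i, s i * (v i ⬝ᵥ x) ^ 2 ∧
        ∑ i, s i * (v i ⬝ᵥ x) ^ 2 ≤ (1 + 10 / q) * (x ⬝ᵥ M *ᵥ x) := by
  -- Write `M = Bᵀ B`; the coordinates `B x` reduce the claim to a decomposition of the identity.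
  obtain ⟨B, hB⟩ := posSemidef_eq_star_mul_self hM.posSemidef
  rw [star_eq_conjTranspose, conjTranspose_eq_transpose_of_trivial] at hB
  have hBu : IsUnit B.det := by
    have := (isUnit_iff_isUnit_det _).1 hM.isUnit
    rw [hB, det_mul, det_transpose] at this
    exact isUnit_of_mul_isUnit_left this
  have h1 : B * B⁻¹ = 1 := mul_nonsing_inv _ hBu
  have h2 : B⁻¹ * B = 1 := nonsing_inv_mul _ hBu
  have hw : ∑ i, vecMulVec (v i ᵥ* B⁻¹) (v i ᵥ* B⁻¹) = 1 := by
    have : ∀ i, vecMulVec (v i ᵥ* B⁻¹) (v i ᵥ* B⁻¹) = (B⁻¹)ᵀ * vecMulVec (v i) (v i) * B⁻¹ := by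
      intro i
      rw [mul_vecMulVec, vecMulVec_mul, mulVec_transpose]
    simp_rw [this]
    rw [← Finset.sum_mul, ← Finset.mul_sum, hv, hB, mul_assoc, mul_assoc, h1, mul_one,
      ← transpose_mul, h1, transpose_one]
  obtain ⟨s, hs0, hsm, hs⟩ := exists_sparsifier_one hw hq
  refine ⟨s, hs0, hsm, fun x => ?_⟩
  have e1 : ∀ i, (v i ᵥ* B⁻¹) ⬝ᵥ (B *ᵥ x) = v i ⬝ᵥ x := by
    intro i
    rw [← dotProduct_mulVec, mulVec_mulVec, h2, one_mulVec]
  have e2 : (B *ᵥ x) ⬝ᵥ (B *ᵥ x) = x ⬝ᵥ M *ᵥ x := by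
    rw [hB, ← mulVec_mulVec, dotProduct_mulVec x, vecMul_transpose]
  have := hs (B *ᵥ x)
  simpa only [e1, e2] using this

end Sparsification

/-! ### SDDM matrices as weighted graphs: sparsification and strongly dominant subsets. -/

section DiagonallyDominant

open Matrix

variable {V : Type*} [Fintype V] [DecidableEq V]

/-- SDDM matrices over an arbitrary finite index type. -/
structure IsSDDMOn (M : Matrix V V ℝ) : Prop where
  symm : Mᵀ = M
  off_nonpos : ∀ i j, i ≠ j → M i j ≤ 0
  row_nonneg : ∀ i, 0 ≤ ∑ j, M i j
  posDef : M.PosDef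

theorem apply_comm_of_transpose_eq {M : Matrix V V ℝ} (h : Mᵀ = M) (i j : V) : M i j = M j i := by
  conv_lhs => rw [← h]
  rfl

theorem quad_eq_sum (M : Matrix V V ℝ) (x : V → ℝ) :
    x ⬝ᵥ M *ᵥ x = ∑ i, ∑ j, M i j * (x i * x j) := by
  simp only [dotProduct, mulVec, Finset.mul_sum]
  exact Finset.sum_congr rfl fun i _ => Finset.sum_congr rfl fun j _ => by ring

/-- The quadratic form of a symmetric matrix, as a sum over edges and vertices. -/
theorem quad_eq_sum_edges {M : Matrix V V ℝ} (h : Mᵀ = M) (x : V → ℝ) :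
    x ⬝ᵥ M *ᵥ x =
      (∑ i, ∑ j, -M i j * (x i - x j) ^ 2) / 2 + ∑ i, (∑ j, M i j) * x i ^ 2 := by
  have e1 : ∑ i, ∑ j, M i j * x j ^ 2 = ∑ i, ∑ j, M i j * x i ^ 2 := by
    rw [Finset.sum_comm]
    exact Finset.sum_congr rfl fun i _ => Finset.sum_congr rfl fun j _ => by
      rw [apply_comm_of_transpose_eq h]
  have e2 : ∑ i, ∑ j, -M i j * (x i - x j) ^ 2 =
      2 * (∑ i, ∑ j, M i j * (x i * x j)) - ∑ i, ∑ j, M i j * x i ^ 2 -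
        ∑ i, ∑ j, M i j * x j ^ 2 := by
    simp only [Finset.mul_sum, ← Finset.sum_sub_distrib]
    exact Finset.sum_congr rfl fun i _ => Finset.sum_congr rfl fun j _ => by ring
  rw [e2, e1, quad_eq_sum]
  simp only [Finset.sum_mul]
  ring

/-- Polarization on pairs of basis vectors. -/
theorem eq_of_quad_eq {A B : Matrix V V ℝ} (hA : Aᵀ = A) (hB : Bᵀ = B)
    (h : ∀ x : V → ℝ, x ⬝ᵥ A *ᵥ x = x ⬝ᵥ B *ᵥ x) : A = B := by
  have key : ∀ {C : Matrix V V ℝ}, Cᵀ = C → ∀ i j, C i j =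
      ((Pi.single i 1 + Pi.single j 1 : V → ℝ) ⬝ᵥ C *ᵥ (Pi.single i 1 + Pi.single j 1) -
        Pi.single i (1 : ℝ) ⬝ᵥ C *ᵥ Pi.single i 1 - Pi.single j (1 : ℝ) ⬝ᵥ C *ᵥ Pi.single j 1) / 2 := by
    intro C hC i j
    have := apply_comm_of_transpose_eq hC i j
    simp [mulVec_add, add_dotProduct, this]
    ring
  ext i j
  rw [key hA, key hB, h, h, h]

/-- The matrix of a weighted graph with edge weights `c` and vertex weights `d`. -/
def graphMatrix (c : V → V → ℝ) (d : V → ℝ) : Matrix V V ℝ := fun i j =>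
  (if i = j then d i + ∑ k, (c i k + c k i) else 0) - (c i j + c j i)

theorem graphMatrix_transpose (c : V → V → ℝ) (d : V → ℝ) :
    (graphMatrix c d)ᵀ = graphMatrix c d := by
  ext i j
  by_cases h : i = j
  · subst h; rfl
  · simp [graphMatrix, h, Ne.symm h, add_comm]

theorem quad_graphMatrix (c : V → V → ℝ) (d : V → ℝ) (x : V → ℝ) :
    x ⬝ᵥ graphMatrix c d *ᵥ x = ∑ i, ∑ j, c i j * (x i - x j) ^ 2 + ∑ i, d i * x i ^ 2 := by
  rw [quad_eq_sum_edges (graphMatrix_transpose c d)]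
  congr 1
  · have e : ∀ i j, -graphMatrix c d i j * (x i - x j) ^ 2 =
        c i j * (x i - x j) ^ 2 + c j i * (x j - x i) ^ 2 := by
      intro i j
      by_cases h : i = j
      · simp [h]
      · simp only [graphMatrix, h, if_false]; ring
    simp only [e, Finset.sum_add_distrib]
    rw [Finset.sum_comm (f := fun i j => c j i * (x j - x i) ^ 2)]
    ring
  · refine Finset.sum_congr rfl fun i _ => ?_
    congr 1
    simp [graphMatrix, Finset.sum_sub_distrib]

theorem graphMatrix_row_sum (c : V → V → ℝ) (d : V → ℝ) (i : V) :
    ∑ j, graphMatrix c d i j = d i := by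
  simp [graphMatrix, Finset.sum_sub_distrib]

theorem graphMatrix_off (c : V → V → ℝ) (d : V → ℝ) {i j : V} (h : i ≠ j) :
    graphMatrix c d i j = -(c i j + c j i) := by
  simp [graphMatrix, h]

/-- The rank-one pieces of an SDDM matrix. -/
noncomputable def edgeVector (M : Matrix V V ℝ) : (V × V) ⊕ V → V → ℝ
  | .inl p => √(-M p.1 p.2 / 2) • (Pi.single p.1 1 - Pi.single p.2 1)
  | .inr i => √(∑ j, M i j) • Pi.single i 1

theorem edgeVector_inl_dotProduct (M : Matrix V V ℝ) (p : V × V) (x : V → ℝ) :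
    edgeVector M (.inl p) ⬝ᵥ x = √(-M p.1 p.2 / 2) * (x p.1 - x p.2) := by
  simp [edgeVector, sub_dotProduct]

theorem edgeVector_inr_dotProduct (M : Matrix V V ℝ) (i : V) (x : V → ℝ) :
    edgeVector M (.inr i) ⬝ᵥ x = √(∑ j, M i j) * x i := by
  simp [edgeVector]

theorem IsSDDMOn.sum_edgeVector {M : Matrix V V ℝ} (hM : IsSDDMOn M) :
    ∑ e, vecMulVec (edgeVector M e) (edgeVector M e) = M := by
  refine eq_of_quad_eq ?_ hM.symm fun x => ?_
  · rw [transpose_sum]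
    exact Finset.sum_congr rfl fun e _ => vecMulVec_self_transpose _
  · have := quad_sum_smul_vecMulVec 1 (edgeVector M) x
    simp only [Pi.one_apply, one_smul, one_mul] at this
    rw [this, quad_eq_sum_edges hM.symm, Fintype.sum_sum_type, Fintype.sum_prod_type]
    congr 1
    · rw [Finset.sum_div]
      refine Finset.sum_congr rfl fun i _ => ?_
      rw [Finset.sum_div]
      refine Finset.sum_congr rfl fun j _ => ?_
      rw [edgeVector_inl_dotProduct, mul_pow]
      by_cases h : i = j
      · simp [h]
      · rw [Real.sq_sqrt (by have := hM.off_nonpos i j h; linarith)]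
        ring
    · refine Finset.sum_congr rfl fun i _ => ?_
      rw [edgeVector_inr_dotProduct, mul_pow, Real.sq_sqrt (hM.row_nonneg i)]

/-- Every SDDM matrix has a spectral approximation by an SDDM matrix with linearly many
nonzero entries. -/
theorem IsSDDMOn.exists_sparse {M : Matrix V V ℝ} (hM : IsSDDMOn M) {q : ℕ} (hq : 10 ≤ q) :
    ∃ N : Matrix V V ℝ, IsSDDMOn N ∧
      {p : V × V | p.2 ≠ p.1 ∧ N p.1 p.2 ≠ 0}.ncard ≤ 2 * (Fintype.card V * q ^ 2) ∧
      ∀ x : V → ℝ, x ⬝ᵥ M *ᵥ x ≤ x ⬝ᵥ N *ᵥ x ∧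
        x ⬝ᵥ N *ᵥ x ≤ (1 + 10 / q) * (x ⬝ᵥ M *ᵥ x) := by
  obtain ⟨s, hs0, hsm, hs⟩ := exists_sparsifier hM.posDef hM.sum_edgeVector hq
  set c : V → V → ℝ := fun i j => s (.inl (i, j)) * √(-M i j / 2) ^ 2 with hc
  set d : V → ℝ := fun i => s (.inr i) * √(∑ j, M i j) ^ 2 with hd
  have hc0 : ∀ i j, 0 ≤ c i j := fun i j => mul_nonneg (hs0 _) (sq_nonneg _)
  have hquad : ∀ x : V → ℝ, ∑ e, s e * (edgeVector M e ⬝ᵥ x) ^ 2 =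
      x ⬝ᵥ graphMatrix c d *ᵥ x := by
    intro x
    rw [quad_graphMatrix, Fintype.sum_sum_type, Fintype.sum_prod_type]
    simp only [edgeVector_inl_dotProduct, edgeVector_inr_dotProduct, mul_pow, hc, hd, mul_assoc]
  simp only [hquad] at hs
  refine ⟨graphMatrix c d, ⟨graphMatrix_transpose c d, ?_, ?_, ?_⟩, ?_, hs⟩
  · intro i j h
    rw [graphMatrix_off c d h]
    linarith [hc0 i j, hc0 j i]
  · intro i
    rw [graphMatrix_row_sum]
    exact mul_nonneg (hs0 _) (sq_nonneg _)
  · exact posDef_of_quad (graphMatrix_transpose c d) fun x hx =>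
      (hM.posDef.quad_pos hx).trans_le (hs x).1
  -- A chosen ordered pair creates at most two off-diagonal entries, itself and its transpose; hence
  -- the factor 2.
  · set E : Set (V × V) := {p | s (.inl p) ≠ 0} with hE
    have hEc : E.ncard ≤ Fintype.card V * q ^ 2 := by
      refine le_trans ?_ hsm
      rw [← Set.ncard_image_of_injective E (Sum.inl_injective (β := V))]
      refine Set.ncard_le_ncard ?_ (Set.toFinite _)
      rintro _ ⟨p, hp, rfl⟩
      exact hp
    have hsub : {p : V × V | p.2 ≠ p.1 ∧ graphMatrix c d p.1 p.2 ≠ 0} ⊆ E ∪ Prod.swap '' E := by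
      rintro ⟨i, j⟩ ⟨h1, h2⟩
      rw [graphMatrix_off c d (Ne.symm h1)] at h2
      by_contra hcon
      have h3 : s (.inl (i, j)) = 0 := by
        by_contra h; exact hcon (Or.inl h)
      have h4 : s (.inl (j, i)) = 0 := by
        by_contra h; exact hcon (Or.inr ⟨(j, i), h, rfl⟩)
      exact h2 (by simp [hc, h3, h4])
    have h5 : (Prod.swap '' E).ncard = E.ncard :=
      Set.ncard_image_of_injective E Prod.swap_injective
    have := (Set.ncard_le_ncard hsub (Set.toFinite _)).trans (Set.ncard_union_le _ _)
    omega

theorem sum_sum_eq_erase_add {g : V → V → ℝ} (hg : ∀ i j, g i j = g j i) (a : V)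
    (ha : g a a = 0) :
    ∑ i, ∑ j, g i j = ∑ i ∈ Finset.univ.erase a, ∑ j ∈ Finset.univ.erase a, g i j +
      2 * ∑ j ∈ Finset.univ.erase a, g a j := by
  have h : ∀ f : V → ℝ, ∑ i, f i = f a + ∑ i ∈ Finset.univ.erase a, f i := fun f =>
    (Finset.add_sum_erase _ f (Finset.mem_univ a)).symm
  rw [h]
  rw [h (g a), ha, Finset.sum_congr rfl fun i _ => h (g i), Finset.sum_add_distrib,
    Finset.sum_congr rfl fun i _ => hg i a]
  ring

/-- Every weighted graph has a `k`-coloring in which each vertex has at most a `k`-th of its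
weight inside its own class. -/
theorem exists_coloring {w : V → V → ℝ} (hw : ∀ i j, w i j = w j i) (hw0 : ∀ i, w i i = 0)
    (k : ℕ) [NeZero k] :
    ∃ f : V → Fin k, ∀ i, k * ∑ j ∈ Finset.univ.filter (fun j => f j = f i), w i j ≤
      ∑ j, w i j := by
  -- A coloring of minimal monochromatic weight cannot be improved by recoloring one vertex, so the
  -- own class of a vertex carries no more of its weight than any other class; averaging over the
  -- classes concludes.
  obtain ⟨f, -, hf⟩ := Finset.exists_min_image Finset.univ
    (fun f : V → Fin k => ∑ i, ∑ j, if f i = f j then w i j else 0)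
    ⟨fun _ => 0, Finset.mem_univ _⟩
  refine ⟨f, fun a => ?_⟩
  have hmove : ∀ c : Fin k, ∑ j ∈ Finset.univ.filter (fun j => f j = f a), w a j ≤
      ∑ j ∈ Finset.univ.filter (fun j => f j = c), w a j := by
    intro c
    have h := hf (Function.update f a c) (Finset.mem_univ _)
    have hs : ∀ f' : V → Fin k, ∀ i j, (if f' i = f' j then w i j else 0) =
        if f' j = f' i then w j i else 0 := by
      intro f' i j; rw [hw i j]; simp only [eq_comm]
    rw [sum_sum_eq_erase_add (hs f) a (by simp [hw0]),
      sum_sum_eq_erase_add (hs (Function.update f a c)) a (by simp [hw0])] at h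
    have e1 : ∑ i ∈ Finset.univ.erase a, ∑ j ∈ Finset.univ.erase a,
        (if Function.update f a c i = Function.update f a c j then w i j else 0) =
        ∑ i ∈ Finset.univ.erase a, ∑ j ∈ Finset.univ.erase a,
          if f i = f j then w i j else 0 := by
      refine Finset.sum_congr rfl fun i hi => Finset.sum_congr rfl fun j hj => ?_
      rw [Function.update_of_ne (Finset.ne_of_mem_erase hi),
        Function.update_of_ne (Finset.ne_of_mem_erase hj)]
    have e2 : ∀ d : Fin k, ∑ j ∈ Finset.univ.filter (fun j => f j = d), w a j =
        ∑ j ∈ Finset.univ.erase a, if d = f j then w a j else 0 := by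
      intro d
      rw [Finset.sum_filter, Finset.sum_erase _ (by simp [hw0])]
      simp only [eq_comm]
    have e3 : ∑ j ∈ Finset.univ.erase a,
        (if Function.update f a c a = Function.update f a c j then w a j else 0) =
        ∑ j ∈ Finset.univ.erase a, if c = f j then w a j else 0 := by
      refine Finset.sum_congr rfl fun j hj => ?_
      rw [Function.update_self, Function.update_of_ne (Finset.ne_of_mem_erase hj)]
    rw [e1, e3] at h
    rw [e2, e2]
    linarith
  calc (k : ℝ) * ∑ j ∈ Finset.univ.filter (fun j => f j = f a), w a j
      = ∑ _c : Fin k, ∑ j ∈ Finset.univ.filter (fun j => f j = f a), w a j := by simp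
    _ ≤ ∑ c : Fin k, ∑ j ∈ Finset.univ.filter (fun j => f j = c), w a j :=
        Finset.sum_le_sum fun c _ => hmove c
    _ = ∑ j, w a j := Finset.sum_fiberwise _ _ _

/-- A sparse SDDM matrix has a large set of rows of small degree whose principal submatrix is
strongly diagonally dominant. -/
theorem IsSDDMOn.exists_dominant_subset {N : Matrix V V ℝ} (hN : IsSDDMOn N) {m : ℕ} (hm : 0 < m)
    (hcard : {p : V × V | p.2 ≠ p.1 ∧ N p.1 p.2 ≠ 0}.ncard ≤ Fintype.card V * m) :
    ∃ F : Finset V, Fintype.card V ≤ 10 * F.card ∧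
      (∀ i ∈ F, {j | j ≠ i ∧ N i j ≠ 0}.ncard ≤ 2 * m) ∧
      ∀ i ∈ F, 5 * ∑ j ∈ F.erase i, |N i j| ≤ N i i := by
  classical
  set w : V → V → ℝ := fun i j => if i = j then 0 else |N i j| with hw
  have hwn : ∀ i j, 0 ≤ w i j := by intro i j; simp only [hw]; split_ifs <;> simp
  obtain ⟨f, hf⟩ := exists_coloring (w := w)
    (by intro i j; simp only [hw, eq_comm (a := i), apply_comm_of_transpose_eq hN.symm i j])
    (by simp [hw]) 5
  set deg : V → ℕ := fun i => (Finset.univ.filter fun j => j ≠ i ∧ N i j ≠ 0).card with hdeg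
  have hsum : ∑ i, deg i ≤ Fintype.card V * m := by
    refine le_trans (le_of_eq ?_) hcard
    rw [Set.ncard_eq_toFinset_card', Set.toFinset_ofPred, Finset.card_filter,
      Fintype.sum_prod_type]
    exact Finset.sum_congr rfl fun i _ => Finset.card_filter _ _
  set B := Finset.univ.filter fun i => deg i ≤ 2 * m with hB
  -- Markov's inequality: the average degree is at most `m`.
  have hB2 : Fintype.card V ≤ 2 * B.card := by
    have h1 : (Finset.univ.filter fun i => ¬ deg i ≤ 2 * m).card * (2 * m) ≤ ∑ i, deg i := by
      rw [← smul_eq_mul, ← Finset.sum_const]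
      refine le_trans (Finset.sum_le_sum fun i hi => ?_)
        (Finset.sum_le_sum_of_subset (Finset.filter_subset _ _))
      have := (Finset.mem_filter.1 hi).2
      omega
    have h2 : B.card + (Finset.univ.filter fun i => ¬ deg i ≤ 2 * m).card = Fintype.card V :=
      Finset.card_filter_add_card_filter_not (s := Finset.univ) fun i => deg i ≤ 2 * m
    have h3 : (Finset.univ.filter fun i => ¬ deg i ≤ 2 * m).card * 2 ≤ Fintype.card V :=
      Nat.le_of_mul_le_mul_right (by linarith) hm
    omega
  -- Some color class contains a fifth of `B`, hence a tenth of all vertices.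
  obtain ⟨c, hc⟩ : ∃ c : Fin 5, B.card ≤ 5 * (B.filter fun i => f i = c).card := by
    by_contra hcon
    push Not at hcon
    have h1 := Finset.card_eq_sum_card_fiberwise (s := B) (t := Finset.univ) (f := f)
      (fun _ _ => by simp)
    have h2 : ∑ c : Fin 5, 5 * (B.filter fun i => f i = c).card < ∑ c : Fin 5, B.card :=
      Finset.sum_lt_sum_of_nonempty Finset.univ_nonempty fun c _ => hcon c
    rw [← Finset.mul_sum, ← h1] at h2
    simp at h2
  refine ⟨B.filter fun i => f i = c, by omega, ?_, ?_⟩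
  · intro i hi
    have := (Finset.mem_filter.1 (Finset.mem_filter.1 hi).1).2
    rwa [Set.ncard_eq_toFinset_card', Set.toFinset_ofPred]
  · intro i hi
    have hic := (Finset.mem_filter.1 hi).2
    have h1 : ∑ j ∈ (B.filter fun i => f i = c).erase i, |N i j| ≤
        ∑ j ∈ Finset.univ.filter (fun j => f j = f i), w i j := by
      refine le_trans (le_of_eq (Finset.sum_congr rfl fun j hj => ?_))
        (Finset.sum_le_sum_of_subset_of_nonneg ?_ fun j _ _ => hwn i j)
      · simp [hw, (Finset.ne_of_mem_erase hj).symm]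
      · intro j hj
        have := (Finset.mem_filter.1 (Finset.mem_of_mem_erase hj)).2
        simp [this, hic]
    have h2 := hf i
    have h3 : ∑ j, w i j ≤ N i i := by
      have h4 : ∑ j, w i j = ∑ j ∈ Finset.univ.erase i, -N i j := by
        rw [← Finset.add_sum_erase _ _ (Finset.mem_univ i)]
        simp only [hw, if_true, zero_add]
        refine Finset.sum_congr rfl fun j hj => ?_
        have hij := (Finset.ne_of_mem_erase hj).symm
        rw [if_neg hij, abs_of_nonpos (hN.off_nonpos i j hij)]
      have h5 := hN.row_nonneg i
      rw [← Finset.add_sum_erase _ _ (Finset.mem_univ i)] at h5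
      rw [h4, Finset.sum_neg_distrib]
      linarith
    push_cast at h2
    linarith

/-- Symmetric diagonally dominant nonsingular matrices are positive definite. -/
theorem IsSDDM.isSDDMOn {n : ℕ} {M : Matrix (Fin n) (Fin n) ℝ} (hM : IsSDDM M) : IsSDDMOn M := by
  have hrow : ∀ i, 0 ≤ ∑ j, M i j := by
    intro i
    have h := hM.diagDominant i
    rw [← Finset.add_sum_erase _ _ (Finset.mem_univ i)]
    have : ∑ j ∈ Finset.univ.erase i, |M i j| = -∑ j ∈ Finset.univ.erase i, M i j := by
      rw [← Finset.sum_neg_distrib]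
      exact Finset.sum_congr rfl fun j hj =>
        abs_of_nonpos (hM.offDiag_nonpos i j (Finset.ne_of_mem_erase hj).symm)
    linarith
  refine ⟨hM.symm, hM.offDiag_nonpos, hrow, ?_⟩
  have hpsd : M.PosSemidef := by
    refine posSemidef_of_quad hM.symm fun x => ?_
    rw [quad_eq_sum_edges hM.symm]
    refine add_nonneg (div_nonneg (Finset.sum_nonneg fun i _ => Finset.sum_nonneg fun j _ => ?_)
      two_pos.le) (Finset.sum_nonneg fun i _ => mul_nonneg (hrow i) (sq_nonneg _))
    by_cases h : i = j
    · simp [h]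
    · exact mul_nonneg (neg_nonneg.2 (hM.offDiag_nonpos i j h)) (sq_nonneg _)
  exact hpsd.posDef_iff_isUnit.2 ((isUnit_iff_isUnit_det _).2 hM.nonsingular)

end DiagonallyDominant

/-! ### Schur complements and approximate elimination by Jacobi iteration. -/

section BlockElimination

open Matrix

variable {F C : Type*} [Fintype F] [DecidableEq F] [Fintype C] [DecidableEq C]

/-- Completing the square in a symmetric block matrix. -/
theorem quad_fromBlocks {A : Matrix F F ℝ} (hA : A.PosDef) (B : Matrix F C ℝ) (D : Matrix C C ℝ)
    (x : F → ℝ) (y : C → ℝ) :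
    Sum.elim x y ⬝ᵥ fromBlocks A B Bᵀ D *ᵥ Sum.elim x y =
      (x + (A⁻¹ * B) *ᵥ y) ⬝ᵥ A *ᵥ (x + (A⁻¹ * B) *ᵥ y) + y ⬝ᵥ (D - Bᵀ * A⁻¹ * B) *ᵥ y := by
  have : Invertible A := hA.isUnit.invertible
  have h := schur_complement_eq₁₁ B D x y hA.1
  simp only [conjTranspose_eq_transpose_of_trivial, star_trivial] at h
  rw [← dotProduct_mulVec, ← dotProduct_mulVec, ← dotProduct_mulVec] at h
  exact h

/-- The minimum principle. -/
theorem nonneg_of_mulVec_nonneg {A : Matrix F F ℝ} (hA : A.PosDef)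
    (hoff : ∀ i j, i ≠ j → A i j ≤ 0) {x : F → ℝ} (hx : ∀ i, 0 ≤ (A *ᵥ x) i) (i : F) :
    0 ≤ x i := by
  -- Test against the negative part `z` of `x`. As `x + z` is the positive part, with disjoint
  -- support, `zᵀ A (x + z) ≤ 0`, while `zᵀ A x ≥ 0`; this contradicts `zᵀ A z > 0` unless `z = 0`.
  set z : F → ℝ := fun i => max (-x i) 0 with hz
  have hz0 : z = 0 := by
    by_contra hne
    have h1 := hA.quad_pos hne
    have h2 : 0 ≤ z ⬝ᵥ A *ᵥ x :=
      Finset.sum_nonneg fun i _ => mul_nonneg (le_max_right _ _) (hx i)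
    have h3 : z ⬝ᵥ A *ᵥ (x + z) ≤ 0 := by
      simp only [dotProduct, mulVec, Finset.mul_sum]
      refine Finset.sum_nonpos fun i _ => Finset.sum_nonpos fun j _ => ?_
      have hzi : 0 ≤ z i := le_max_right _ _
      have hxz : 0 ≤ (x + z) j := by
        have : -x j ≤ z j := le_max_left _ _
        simp only [Pi.add_apply]; linarith
      by_cases hij : i = j
      · subst hij
        have : z i * (x + z) i = 0 := by
          simp only [hz, Pi.add_apply]
          rcases le_total (-x i) 0 with h | h
          · simp [max_eq_right h]
          · simp [max_eq_left h]
        rw [mul_left_comm, this, mul_zero]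
      · exact mul_nonpos_of_nonneg_of_nonpos hzi
          (mul_nonpos_of_nonpos_of_nonneg (hoff i j hij) hxz)
    rw [mulVec_add, dotProduct_add] at h3
    linarith
  have : max (-x i) 0 = 0 := congrFun hz0 i
  have := le_max_left (-x i) 0
  linarith

/-- Schur complements of SDDM matrices are SDDM. -/
theorem IsSDDMOn.schur {A : Matrix F F ℝ} {B : Matrix F C ℝ} {D : Matrix C C ℝ}
    (h : IsSDDMOn (fromBlocks A B Bᵀ D)) : A.PosDef ∧ IsSDDMOn (D - Bᵀ * A⁻¹ * B) := by
  have hA : A.PosDef :=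
    h.posDef.submatrix (e := Sum.inl) Sum.inl_injective
  have hD : Dᵀ = D := by
    have := h.symm
    rw [fromBlocks_transpose] at this
    exact (fromBlocks_inj.1 this).2.2.2
  have hoffA : ∀ i j, i ≠ j → A i j ≤ 0 := fun i j hij =>
    h.off_nonpos (.inl i) (.inl j) (by simpa using hij)
  have hB : ∀ i j, B i j ≤ 0 := fun i j => h.off_nonpos (.inl i) (.inr j) (by simp)
  have hrF : ∀ i, 0 ≤ ∑ j, A i j + ∑ j, B i j := fun i => by
    simpa [Fintype.sum_sum_type] using h.row_nonneg (.inl i)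
  have hrC : ∀ i, 0 ≤ ∑ j, B j i + ∑ j, D i j := fun i => by
    simpa [Fintype.sum_sum_type] using h.row_nonneg (.inr i)
  have hAs : (A⁻¹)ᵀ = A⁻¹ := hA.inv.posSemidef.transpose_eq
  have hS : (D - Bᵀ * A⁻¹ * B)ᵀ = D - Bᵀ * A⁻¹ * B := by
    rw [transpose_sub, transpose_mul, transpose_mul, transpose_transpose, hAs, hD, Matrix.mul_assoc]
  refine ⟨hA, hS, ?_, ?_, ?_⟩
  · intro i j hij
    have h1 : D i j ≤ 0 := h.off_nonpos (.inr i) (.inr j) (by simpa using hij)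
    have h2 : ∀ k, 0 ≤ (A⁻¹ *ᵥ fun l => -B l j) k := by
      refine nonneg_of_mulVec_nonneg hA hoffA fun k => ?_
      rw [mulVec_mulVec, hA.mul_inv, one_mulVec]
      exact neg_nonneg.2 (hB k j)
    have h3 : (Bᵀ * A⁻¹ * B) i j = ∑ k, -B k i * (A⁻¹ *ᵥ fun l => -B l j) k := by
      rw [Matrix.mul_assoc, mul_apply]
      refine Finset.sum_congr rfl fun k _ => ?_
      simp [mul_apply, mulVec, dotProduct, Finset.sum_neg_distrib]
    rw [Matrix.sub_apply, h3]
    have : 0 ≤ ∑ k, -B k i * (A⁻¹ *ᵥ fun l => -B l j) k :=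
      Finset.sum_nonneg fun k _ => mul_nonneg (neg_nonneg.2 (hB k i)) (h2 k)
    linarith
  · intro i
    -- `A z` is the vector of full row sums over `F`, so `z ≥ 0`. The row sums of the Schur
    -- complement are those over `C` minus `Bᵀ z`, and `B ≤ 0`.
    set z : F → ℝ := 1 + A⁻¹ *ᵥ (B *ᵥ 1) with hz
    have hz0 : ∀ k, 0 ≤ z k := by
      refine nonneg_of_mulVec_nonneg hA hoffA fun k => ?_
      rw [hz, mulVec_add, mulVec_mulVec, hA.mul_inv, one_mulVec]
      simpa [mulVec, dotProduct] using hrF k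
    have e1 : ∑ j, (D - Bᵀ * A⁻¹ * B) i j = ((D - Bᵀ * A⁻¹ * B) *ᵥ 1) i := by
      simp [mulVec, dotProduct]
    have e2 : (D - Bᵀ * A⁻¹ * B) *ᵥ 1 = D *ᵥ 1 + Bᵀ *ᵥ 1 - Bᵀ *ᵥ z := by
      rw [hz, sub_mulVec, mulVec_add, mulVec_mulVec, mulVec_mulVec]
      abel
    rw [e1, e2]
    have h1 : 0 ≤ (D *ᵥ 1 + Bᵀ *ᵥ 1) i := by
      have := hrC i
      simp only [Pi.add_apply, mulVec, dotProduct, transpose_apply, Pi.one_apply, mul_one]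
      linarith
    have h2 : (Bᵀ *ᵥ z) i ≤ 0 :=
      Finset.sum_nonpos fun k _ => mul_nonpos_of_nonpos_of_nonneg (hB k i) (hz0 k)
    rw [Pi.sub_apply]
    linarith
  · refine posDef_of_quad hS fun y hy => ?_
    have h1 := quad_fromBlocks hA B D (-((A⁻¹ * B) *ᵥ y)) y
    rw [neg_add_cancel, mulVec_zero, dotProduct_zero, zero_add] at h1
    rw [← h1]
    refine h.posDef.quad_pos fun h0 => hy ?_
    funext i
    exact congrFun h0 (.inr i)

/-- The Laplacian part of a square matrix: the matrix minus the diagonal of its row sums. -/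
def laplacianPart (A : Matrix F F ℝ) : Matrix F F ℝ := A - diagonal fun i => ∑ j, A i j

theorem laplacianPart_transpose {A : Matrix F F ℝ} (hA : Aᵀ = A) :
    (laplacianPart A)ᵀ = laplacianPart A := by
  rw [laplacianPart, transpose_sub, hA, diagonal_transpose]

theorem quad_diagonal (d x : F → ℝ) : x ⬝ᵥ diagonal d *ᵥ x = ∑ i, d i * x i ^ 2 := by
  simp only [dotProduct, mulVec_diagonal]
  exact Finset.sum_congr rfl fun i _ => by ring

theorem quad_laplacianPart {A : Matrix F F ℝ} (hA : Aᵀ = A) (x : F → ℝ) :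
    x ⬝ᵥ laplacianPart A *ᵥ x = (∑ i, ∑ j, -A i j * (x i - x j) ^ 2) / 2 := by
  rw [laplacianPart, sub_mulVec, dotProduct_sub, quad_diagonal, quad_eq_sum_edges hA]
  ring

theorem quad_eq_diag_add_laplacianPart (A : Matrix F F ℝ) (x : F → ℝ) :
    x ⬝ᵥ A *ᵥ x = ∑ i, (∑ j, A i j) * x i ^ 2 + x ⬝ᵥ laplacianPart A *ᵥ x := by
  rw [laplacianPart, sub_mulVec, dotProduct_sub, quad_diagonal]
  ring

/-- The edges inside `F` are among the edges of the whole graph, and all other terms of the form are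
nonnegative. -/
theorem laplacianPart_quad_le {A : Matrix F F ℝ} {B : Matrix F C ℝ} {D : Matrix C C ℝ}
    (h : IsSDDMOn (fromBlocks A B Bᵀ D)) (x : F → ℝ) (y : C → ℝ) :
    x ⬝ᵥ laplacianPart A *ᵥ x ≤ Sum.elim x y ⬝ᵥ fromBlocks A B Bᵀ D *ᵥ Sum.elim x y := by
  have hA : Aᵀ = A := h.schur.1.posSemidef.transpose_eq
  rw [quad_laplacianPart hA, quad_eq_sum_edges h.symm]
  have hterm : ∀ u v, 0 ≤ -fromBlocks A B Bᵀ D u v * (Sum.elim x y u - Sum.elim x y v) ^ 2 := by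
    intro u v
    by_cases huv : u = v
    · simp [huv]
    · exact mul_nonneg (neg_nonneg.2 (h.off_nonpos u v huv)) (sq_nonneg _)
  have h1 : 0 ≤ ∑ u, (∑ v, fromBlocks A B Bᵀ D u v) * Sum.elim x y u ^ 2 :=
    Finset.sum_nonneg fun u _ => mul_nonneg (h.row_nonneg u) (sq_nonneg _)
  have h2 : ∑ i, ∑ j, -A i j * (x i - x j) ^ 2 ≤
      ∑ u, ∑ v, -fromBlocks A B Bᵀ D u v * (Sum.elim x y u - Sum.elim x y v) ^ 2 := by
    rw [Fintype.sum_sum_type]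
    refine le_trans (Finset.sum_le_sum fun i _ => ?_)
      (le_add_of_nonneg_right (Finset.sum_nonneg fun u _ => Finset.sum_nonneg fun v _ => hterm _ _))
    rw [Fintype.sum_sum_type]
    exact le_add_of_nonneg_right (Finset.sum_nonneg fun v _ => hterm (.inl i) (.inr v))
  linarith

/-- `A` has nonpositive off-diagonal entries whose row sums are at most a fifth of the diagonal. -/
structure StronglyDominant (A : Matrix F F ℝ) : Prop where
  symm : Aᵀ = A
  off_nonpos : ∀ i j, i ≠ j → A i j ≤ 0
  diag_pos : ∀ i, 0 < A i i
  dominant : ∀ i, 5 * ∑ j ∈ Finset.univ.erase i, |A i j| ≤ A i i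

namespace StronglyDominant

variable {A : Matrix F F ℝ}

theorem four_mul_le (hA : StronglyDominant A) (i : F) :
    4 * ∑ j ∈ Finset.univ.erase i, |A i j| ≤ ∑ j, A i j := by
  rw [← Finset.add_sum_erase _ _ (Finset.mem_univ i)]
  have h : ∑ j ∈ Finset.univ.erase i, |A i j| = -∑ j ∈ Finset.univ.erase i, A i j := by
    rw [← Finset.sum_neg_distrib]
    exact Finset.sum_congr rfl fun j hj =>
      abs_of_nonpos (hA.off_nonpos i j (Finset.ne_of_mem_erase hj).symm)
  linarith [hA.dominant i]

theorem row_pos (hA : StronglyDominant A) (i : F) : 0 < ∑ j, A i j := by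
  have h1 := hA.four_mul_le i
  have h2 := hA.dominant i
  have h3 := hA.diag_pos i
  have h4 : 0 ≤ ∑ j ∈ Finset.univ.erase i, |A i j| := Finset.sum_nonneg fun j _ => abs_nonneg _
  rw [← Finset.add_sum_erase _ _ (Finset.mem_univ i)] at h1 ⊢
  have h5 : -∑ j ∈ Finset.univ.erase i, |A i j| ≤ ∑ j ∈ Finset.univ.erase i, A i j := by
    rw [← Finset.sum_neg_distrib]
    exact Finset.sum_le_sum fun j _ => neg_abs_le _
  linarith

theorem laplacianPart_posSemidef (hA : StronglyDominant A) : (laplacianPart A).PosSemidef := by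
  refine posSemidef_of_quad (laplacianPart_transpose hA.symm) fun x => ?_
  rw [quad_laplacianPart hA.symm]
  refine div_nonneg (Finset.sum_nonneg fun i _ => Finset.sum_nonneg fun j _ => ?_) two_pos.le
  by_cases h : i = j
  · simp [h]
  · exact mul_nonneg (neg_nonneg.2 (hA.off_nonpos i j h)) (sq_nonneg _)

/-- Use `(x i - x j)² ≤ 2 (x i)² + 2 (x j)²` on each edge; the off-diagonal weight of a row is at
most a quarter of its row sum. -/
theorem laplacianPart_le (hA : StronglyDominant A) (x : F → ℝ) :
    x ⬝ᵥ laplacianPart A *ᵥ x ≤ (∑ i, (∑ j, A i j) * x i ^ 2) / 2 := by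
  rw [quad_laplacianPart hA.symm]
  set w : F → F → ℝ := fun i j => if i = j then 0 else |A i j| with hw
  have hws : ∀ i j, w i j = w j i := by
    intro i j
    simp only [hw, eq_comm (a := i), apply_comm_of_transpose_eq hA.symm i j]
  have hwr : ∀ i, ∑ j, w i j = ∑ j ∈ Finset.univ.erase i, |A i j| := by
    intro i
    rw [← Finset.add_sum_erase _ _ (Finset.mem_univ i)]
    simp only [hw, if_true, zero_add]
    exact Finset.sum_congr rfl fun j hj => by simp [(Finset.ne_of_mem_erase hj).symm]
  have h1 : ∑ i, ∑ j, -A i j * (x i - x j) ^ 2 ≤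
      ∑ i, ∑ j, (w i j * (2 * x i ^ 2) + w i j * (2 * x j ^ 2)) := by
    refine Finset.sum_le_sum fun i _ => Finset.sum_le_sum fun j _ => ?_
    by_cases h : i = j
    · simp [h, hw]
    · simp only [hw, h, if_false, abs_of_nonpos (hA.off_nonpos i j h)]
      nlinarith [mul_nonneg (neg_nonneg.2 (hA.off_nonpos i j h)) (sq_nonneg (x i + x j))]
  have h2 : ∑ i, ∑ j, w i j * (2 * x j ^ 2) = ∑ i, ∑ j, w i j * (2 * x i ^ 2) := by
    rw [Finset.sum_comm]
    exact Finset.sum_congr rfl fun i _ => Finset.sum_congr rfl fun j _ => by rw [hws]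
  have h3 : ∑ i, ∑ j, w i j * (2 * x i ^ 2) ≤ (∑ i, (∑ j, A i j) * x i ^ 2) / 2 := by
    rw [Finset.sum_div]
    refine Finset.sum_le_sum fun i _ => ?_
    rw [← Finset.sum_mul, hwr]
    nlinarith [hA.four_mul_le i, sq_nonneg (x i)]
  simp only [Finset.sum_add_distrib] at h1
  rw [h2] at h1
  linarith

/-- One Jacobi step contracts, from the Laplacian seminorm to the diagonal norm. -/
theorem jacobi_contract (hA : StronglyDominant A) (z : F → ℝ) :
    ∑ i, (∑ j, A i j) * ((∑ j, A i j)⁻¹ * (laplacianPart A *ᵥ z) i) ^ 2 ≤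
      (z ⬝ᵥ laplacianPart A *ᵥ z) / 2 := by
  set p : F → ℝ := fun i => (∑ j, A i j)⁻¹ * (laplacianPart A *ᵥ z) i with hp
  set n := ∑ i, (∑ j, A i j) * p i ^ 2 with hn
  have h1 : n = p ⬝ᵥ laplacianPart A *ᵥ z := by
    refine Finset.sum_congr rfl fun i _ => ?_
    have := (hA.row_pos i).ne'
    simp only [hp]
    field_simp
  have h2 := hA.laplacianPart_posSemidef.cauchy_schwarz p z
  have h3 := hA.laplacianPart_le p
  have h4 := hA.laplacianPart_posSemidef.quad_nonneg z
  have h5 : 0 ≤ n := Finset.sum_nonneg fun i _ => mul_nonneg (hA.row_pos i).le (sq_nonneg _)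
  rw [← h1] at h2
  rw [← hn] at h3
  rcases h5.eq_or_lt with h | h
  · rw [← h]; linarith
  · have : n ^ 2 ≤ n * ((z ⬝ᵥ laplacianPart A *ᵥ z) / 2) := by nlinarith
    rw [sq] at this
    exact le_of_mul_le_mul_left this h

end StronglyDominant

/-- The Jacobi iterates for `A * H = B`, preconditioned by the diagonal of row sums. -/
noncomputable def jacobi (A : Matrix F F ℝ) (B : Matrix F C ℝ) : ℕ → Matrix F C ℝ
  | 0 => 0
  | s + 1 => diagonal (fun i => (∑ j, A i j)⁻¹) * (B - laplacianPart A * jacobi A B s)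

/-- A step multiplies the error by `-X⁻¹ L`, which contracts the squared `X`-norm by 4. The first
step, from the zero iterate, is measured in the Laplacian seminorm of the exact solution, a quantity
the Schur complement controls. -/
theorem StronglyDominant.jacobi_error {A : Matrix F F ℝ} (hA : StronglyDominant A) (hP : A.PosDef)
    (B : Matrix F C ℝ) (y : C → ℝ) (s : ℕ) :
    ∑ i, (∑ j, A i j) * ((jacobi A B (s + 1) *ᵥ y - (A⁻¹ * B) *ᵥ y) i) ^ 2 ≤
      (1 / 4) ^ s * ((((A⁻¹ * B) *ᵥ y) ⬝ᵥ laplacianPart A *ᵥ ((A⁻¹ * B) *ᵥ y)) / 2) := by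
  set h := (A⁻¹ * B) *ᵥ y with hh
  have hfix : B *ᵥ y = (diagonal fun i => ∑ j, A i j) *ᵥ h + laplacianPart A *ᵥ h := by
    rw [← add_mulVec, laplacianPart, add_sub_cancel, hh, mulVec_mulVec, ← Matrix.mul_assoc, hP.mul_inv,
      Matrix.one_mul]
  have hstep : ∀ s, jacobi A B (s + 1) *ᵥ y - h = fun i => (∑ j, A i j)⁻¹ *
      (laplacianPart A *ᵥ -(jacobi A B s *ᵥ y - h)) i := by
    intro s
    funext i
    have h0 := (hA.row_pos i).ne'
    rw [jacobi, ← mulVec_mulVec, sub_mulVec, ← mulVec_mulVec, hfix, Pi.sub_apply,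
      mulVec_diagonal, mulVec_neg, mulVec_sub]
    simp only [Pi.sub_apply, Pi.add_apply, Pi.neg_apply, mulVec_diagonal]
    field_simp
    ring
  induction s with
  | zero =>
    rw [hstep]
    refine (hA.jacobi_contract _).trans (le_of_eq ?_)
    simp [jacobi]
  | succ s ih =>
    rw [hstep]
    refine (hA.jacobi_contract _).trans ?_
    rw [mulVec_neg, dotProduct_neg, neg_dotProduct, neg_neg, pow_succ]
    have := hA.laplacianPart_le (jacobi A B (s + 1) *ᵥ y - h)
    linarith

/-- The cross term is split by the weighted inequality `2 aᵀ A e ≤ γ aᵀ A a + γ⁻¹ eᵀ A e`. The slack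
`s`, later the Schur complement energy, pays for the part due to `e`. -/
theorem Matrix.PosSemidef.perturb {A : Matrix F F ℝ} (hA : A.PosSemidef) {γ s : ℝ} (hγ : 0 < γ)
    (hs : 0 ≤ s) (a e : F → ℝ) (he : e ⬝ᵥ A *ᵥ e ≤ γ ^ 2 * s) :
    (a + e) ⬝ᵥ A *ᵥ (a + e) + s ≤ (1 + γ) ^ 2 * (a ⬝ᵥ A *ᵥ a + s) := by
  have h := hA.quad_nonneg (γ • a - e)
  have ha := hA.quad_nonneg a
  simp only [mulVec_add, mulVec_sub, mulVec_smul, dotProduct_add, add_dotProduct, dotProduct_sub,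
    sub_dotProduct, dotProduct_smul, smul_dotProduct, smul_eq_mul] at h ⊢
  rw [IsSymm.dotProduct_mulVec_comm hA.transpose_eq e a] at h ⊢
  have h1 : 2 * (a ⬝ᵥ A *ᵥ e) ≤ γ * (a ⬝ᵥ A *ᵥ a) + γ * s := by
    have : γ * (2 * (a ⬝ᵥ A *ᵥ e)) ≤ γ * (γ * (a ⬝ᵥ A *ᵥ a) + γ * s) := by nlinarith
    exact le_of_mul_le_mul_left this hγ
  nlinarith [mul_nonneg hγ.le hs, mul_nonneg hγ.le ha, mul_nonneg (sq_nonneg γ) ha]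

/-- Approximate block elimination of a strongly dominant block. -/
theorem StronglyDominant.block_elimination {A : Matrix F F ℝ} {B : Matrix F C ℝ}
    {D : Matrix C C ℝ} (h : IsSDDMOn (fromBlocks A B Bᵀ D)) (hA : StronglyDominant A) (s : ℕ)
    (x : F → ℝ) (y : C → ℝ) :
    ∑ i, (∑ j, A i j) * ((x + jacobi A B (s + 1) *ᵥ y) i) ^ 2 +
        y ⬝ᵥ (D - Bᵀ * A⁻¹ * B) *ᵥ y ≤
      (1 + (1 / 2) ^ s) ^ 2 * (Sum.elim x y ⬝ᵥ fromBlocks A B Bᵀ D *ᵥ Sum.elim x y) ∧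
    Sum.elim x y ⬝ᵥ fromBlocks A B Bᵀ D *ᵥ Sum.elim x y ≤
      (1 + (1 / 2) ^ s) ^ 2 *
        (3 / 2 * ∑ i, (∑ j, A i j) * ((x + jacobi A B (s + 1) *ᵥ y) i) ^ 2 +
          y ⬝ᵥ (D - Bᵀ * A⁻¹ * B) *ᵥ y) := by
  obtain ⟨hP, hS⟩ := h.schur
  set H := jacobi A B (s + 1) *ᵥ y with hH
  set h₀ := (A⁻¹ * B) *ᵥ y with hh₀
  set S := y ⬝ᵥ (D - Bᵀ * A⁻¹ * B) *ᵥ y with hSdef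
  have hS0 : 0 ≤ S := hS.posDef.posSemidef.quad_nonneg y
  -- For fixed `y` the form is minimal at `x = -h₀`, where it equals `S`.
  have hL : h₀ ⬝ᵥ laplacianPart A *ᵥ h₀ ≤ S := by
    have h1 := laplacianPart_quad_le h (-h₀) y
    rw [quad_fromBlocks hP, ← hh₀, neg_add_cancel, mulVec_zero, dotProduct_zero, zero_add,
      mulVec_neg, dotProduct_neg, neg_dotProduct, neg_neg] at h1
    exact h1
  have herr : (H - h₀) ⬝ᵥ A *ᵥ (H - h₀) ≤ ((1 / 2) ^ s) ^ 2 * S := by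
    have h1 := hA.jacobi_error hP B y s
    rw [← hH, ← hh₀] at h1
    have h2 := hA.laplacianPart_le (H - h₀)
    rw [quad_eq_diag_add_laplacianPart]
    have h3 : (((1 : ℝ) / 2) ^ s) ^ 2 = (1 / 4) ^ s := by rw [← pow_mul, mul_comm, pow_mul]; norm_num
    rw [h3]
    have h4 : (0 : ℝ) ≤ (1 / 4) ^ s := by positivity
    nlinarith [mul_le_mul_of_nonneg_left hL h4, mul_nonneg h4 hS0]
  have hγ : (0 : ℝ) < (1 / 2) ^ s := by positivity
  rw [quad_fromBlocks hP, ← hh₀, ← hSdef]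
  have e1 : x + H = (x + h₀) + (H - h₀) := by abel
  have e2 : x + h₀ = (x + H) + -(H - h₀) := by abel
  have hq := quad_eq_diag_add_laplacianPart A (x + H)
  have hLle := hA.laplacianPart_le (x + H)
  have hL0 := hA.laplacianPart_posSemidef.quad_nonneg (x + H)
  constructor
  · have h1 := hP.posSemidef.perturb hγ hS0 (x + h₀) (H - h₀) herr
    rw [← e1] at h1
    linarith
  · have h1 := hP.posSemidef.perturb hγ hS0 (x + H) (-(H - h₀)) (by
      rwa [mulVec_neg, dotProduct_neg, neg_dotProduct, neg_neg])
    rw [← e2] at h1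
    refine h1.trans (mul_le_mul_of_nonneg_left ?_ (by positivity))
    linarith

/-- The Jacobi iterates are sparse. -/
theorem jacobi_row_ncard {A : Matrix F F ℝ} {B : Matrix F C ℝ} {m : ℕ}
    (hm : ∀ i, {j | j ≠ i ∧ A i j ≠ 0}.ncard + {j | B i j ≠ 0}.ncard ≤ m) (s : ℕ) (i : F) :
    {j | jacobi A B s i j ≠ 0}.ncard + 1 ≤ (m + 1) ^ s := by
  classical
  -- The summand `+ 1` closes the recurrence: a new row is supported on a row of `B` and on the old
  -- rows of `i` and its neighbors.
  induction s generalizing i with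
  | zero => simp [jacobi]
  | succ s ih =>
    set G : Finset F := insert i (Finset.univ.filter fun k => k ≠ i ∧ A i k ≠ 0) with hG
    have hsub : {j | jacobi A B (s + 1) i j ≠ 0} ⊆
        {j | B i j ≠ 0} ∪ ⋃ k ∈ G, {j | jacobi A B s k j ≠ 0} := by
      intro j hj
      by_contra hcon
      simp only [Set.mem_union, Set.mem_iUnion, not_or, not_exists] at hcon
      obtain ⟨hB, hJ⟩ := hcon
      have hB : B i j = 0 := by by_contra h; exact hB h
      have hJ : ∀ k ∈ G, jacobi A B s k j = 0 := fun k hk => by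
        by_contra h; exact hJ k hk h
      refine hj ?_
      rw [jacobi, diagonal_mul, Matrix.sub_apply, hB, mul_apply,
        Finset.sum_eq_zero (f := fun k => laplacianPart A i k * jacobi A B s k j), sub_zero,
        mul_zero]
      intro k _
      by_cases hk : k ∈ G
      · rw [hJ k hk, mul_zero]
      · have : laplacianPart A i k = 0 := by
          simp only [hG, Finset.mem_insert, Finset.mem_filter, Finset.mem_univ, true_and,
            not_or] at hk
          have hAik : A i k = 0 := by
            by_contra h; exact hk.2 ⟨hk.1, h⟩
          rw [laplacianPart, Matrix.sub_apply, diagonal_apply_ne _ (Ne.symm hk.1), hAik, sub_zero]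
        rw [this, zero_mul]
    have h1 := Set.ncard_le_ncard hsub (Set.toFinite _)
    have h2 : (⋃ k ∈ G, {j | jacobi A B s k j ≠ 0}).ncard ≤ G.card * ((m + 1) ^ s - 1) := by
      refine (Finset.set_ncard_biUnion_le _ _).trans ?_
      rw [← smul_eq_mul, ← Finset.sum_const]
      exact Finset.sum_le_sum fun k _ => Nat.le_sub_of_add_le (ih k)
    have h3 : G.card ≤ {j | j ≠ i ∧ A i j ≠ 0}.ncard + 1 := by
      refine (Finset.card_insert_le _ _).trans ?_
      rw [Set.ncard_eq_toFinset_card', Set.toFinset_ofPred]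
    have h4 := Set.ncard_union_le {j | B i j ≠ 0} (⋃ k ∈ G, {j | jacobi A B s k j ≠ 0})
    have h5 := hm i
    have h6 : 1 ≤ (m + 1) ^ s := Nat.one_le_pow _ _ (by omega)
    obtain ⟨r, hr⟩ := Nat.exists_eq_add_of_le h6
    rw [pow_succ, hr]
    rw [hr, Nat.add_sub_cancel_left] at h2
    nlinarith

end BlockElimination

/-! ### Recursive assembly of the levels. -/

section LevelFactorization

open Matrix

/-- `Uᵀ diag(d) U` approximates `M` within the factors `c` and `3 c / 2`, and `U` is unit
triangular, with at most `T` nonzero entries off the diagonal, all of which lead from a level to a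
strictly higher one, among `K` levels. -/
structure IsLevelFactorization {V : Type*} [Fintype V] (M U : Matrix V V ℝ) (d : V → ℝ)
    (ℓ : V → ℕ) (K : ℕ) (T c : ℝ) : Prop where
  unit : ∀ v, U v v = 1
  level : ∀ u v, U u v ≠ 0 → u = v ∨ ℓ u < ℓ v
  level_lt : ∀ v, ℓ v < K
  sparse : ({p : V × V | p.1 ≠ p.2 ∧ U p.1 p.2 ≠ 0}.ncard : ℝ) ≤ T
  upper : ∀ x : V → ℝ, ∑ v, d v * (U *ᵥ x) v ^ 2 ≤ c * (x ⬝ᵥ M *ᵥ x)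
  lower : ∀ x : V → ℝ, x ⬝ᵥ M *ᵥ x ≤ c * (3 / 2 * ∑ v, d v * (U *ᵥ x) v ^ 2)

theorem quad_submatrix_equiv {V W : Type*} [Fintype V] [Fintype W] (e : W ≃ V)
    (M : Matrix V V ℝ) (x : V → ℝ) :
    (x ∘ e) ⬝ᵥ M.submatrix e e *ᵥ (x ∘ e) = x ⬝ᵥ M *ᵥ x := by
  rw [submatrix_mulVec_equiv, Function.comp_assoc, Equiv.self_comp_symm, Function.comp_id,
    comp_equiv_dotProduct_comp_equiv]

theorem IsSDDMOn.submatrix {V W : Type*} [Fintype V] [Fintype W] {M : Matrix V V ℝ}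
    (hM : IsSDDMOn M) (e : W ≃ V) : IsSDDMOn (M.submatrix e e) where
  symm := by rw [transpose_submatrix, hM.symm]
  off_nonpos i j h := hM.off_nonpos _ _ (e.injective.ne h)
  row_nonneg i := by
    have := hM.row_nonneg (e i)
    rwa [← e.sum_comp] at this
  posDef := hM.posDef.submatrix e.injective

theorem IsLevelFactorization.of_submatrix {V W : Type*} [Fintype V] [Fintype W]
    {M : Matrix V V ℝ} (e : W ≃ V) {U : Matrix W W ℝ} {d : W → ℝ} {ℓ : W → ℕ} {K : ℕ} {T c : ℝ}
    (h : IsLevelFactorization (M.submatrix e e) U d ℓ K T c) :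
    IsLevelFactorization M (U.submatrix e.symm e.symm) (d ∘ e.symm) (ℓ ∘ e.symm) K T c := by
  have hsum : ∀ x : V → ℝ, ∑ v, (d ∘ e.symm) v * (U.submatrix e.symm e.symm *ᵥ x) v ^ 2 =
      ∑ w, d w * (U *ᵥ (x ∘ e)) w ^ 2 := by
    intro x
    rw [submatrix_mulVec_equiv, ← e.symm.sum_comp fun w => d w * (U *ᵥ (x ∘ e)) w ^ 2]
    rfl
  refine ⟨fun v => h.unit _, fun u v huv => ?_, fun v => h.level_lt _, ?_, fun x => ?_,
    fun x => ?_⟩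
  · exact (h.level _ _ huv).imp (fun h => e.symm.injective h) id
  · refine le_trans ?_ h.sparse
    rw [← Set.ncard_image_of_injective {p : W × W | p.1 ≠ p.2 ∧ U p.1 p.2 ≠ 0}
      (e.prodCongr e).injective]
    refine Nat.cast_le.2 (Set.ncard_le_ncard ?_ (Set.toFinite _))
    rintro ⟨u, v⟩ ⟨h1, h2⟩
    exact ⟨(e.symm u, e.symm v), ⟨e.symm.injective.ne h1, h2⟩, by simp⟩
  · rw [hsum, ← quad_submatrix_equiv e]; exact h.upper _
  · rw [hsum, ← quad_submatrix_equiv e]; exact h.lower _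

theorem IsLevelFactorization.of_approx {V : Type*} [Fintype V] {M N U : Matrix V V ℝ}
    {d : V → ℝ} {ℓ : V → ℕ} {K : ℕ} {T c a : ℝ} (h : IsLevelFactorization N U d ℓ K T c)
    (hN : ∀ x : V → ℝ, 0 ≤ x ⬝ᵥ N *ᵥ x) (hc : 0 ≤ c) (ha : 1 ≤ a)
    (hMN : ∀ x : V → ℝ, x ⬝ᵥ M *ᵥ x ≤ x ⬝ᵥ N *ᵥ x ∧ x ⬝ᵥ N *ᵥ x ≤ a * (x ⬝ᵥ M *ᵥ x)) :
    IsLevelFactorization M U d ℓ K T (a * c) where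
  unit := h.unit
  level := h.level
  level_lt := h.level_lt
  sparse := h.sparse
  upper x := by
    have := mul_le_mul_of_nonneg_left (hMN x).2 hc
    linarith [h.upper x]
  lower x := by
    have h1 := h.lower x
    have h2 := (hMN x).1
    have h3 := hN x
    rw [mul_assoc]
    exact h2.trans (h1.trans (le_mul_of_one_le_left (h3.trans h1) ha))

theorem ncard_le_of_row_ncard_le {α β : Type*} [Fintype α] [Fintype β] {P : α → β → Prop} {R : ℕ}
    (h : ∀ a, {b | P a b}.ncard ≤ R) : {p : α × β | P p.1 p.2}.ncard ≤ Fintype.card α * R := by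
  classical
  rw [Set.ncard_eq_toFinset_card', Set.toFinset_ofPred, Finset.card_filter, Fintype.sum_prod_type,
    ← Finset.card_univ, ← smul_eq_mul, ← Finset.sum_const]
  refine Finset.sum_le_sum fun a _ => ?_
  have := h a
  rw [Set.ncard_eq_toFinset_card', Set.toFinset_ofPred, Finset.card_filter] at this
  exact this

/-- The new vertices form level 0 below the shifted old ones. Only `(1 + (1/2)^s)²` multiplies the
constant: the pivot factor `3/2` falls on the new block alone, beside the one already present on the
old blocks. -/
theorem IsLevelFactorization.extend {F C : Type*} [Fintype F] [DecidableEq F] [Fintype C]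
    [DecidableEq C] {A : Matrix F F ℝ} {B : Matrix F C ℝ} {D U : Matrix C C ℝ} {d : C → ℝ}
    {ℓ : C → ℕ} {K : ℕ} {T c : ℝ} (h : IsSDDMOn (fromBlocks A B Bᵀ D)) (hA : StronglyDominant A)
    {m : ℕ} (hm : ∀ i, {j | j ≠ i ∧ A i j ≠ 0}.ncard + {j | B i j ≠ 0}.ncard ≤ m) (s : ℕ)
    (hc : 1 ≤ c) (hU : IsLevelFactorization (D - Bᵀ * A⁻¹ * B) U d ℓ K T c) :
    IsLevelFactorization (fromBlocks A B Bᵀ D) (fromBlocks 1 (jacobi A B (s + 1)) 0 U)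
      (Sum.elim (fun i => ∑ j, A i j) d) (Sum.elim (fun _ => 0) fun v => ℓ v + 1) (K + 1)
      (Fintype.card F * ((m + 1) ^ (s + 1) : ℕ) + T) ((1 + (1 / 2) ^ s) ^ 2 * c) := by
  have hsum : ∀ x : F → ℝ, ∀ y : C → ℝ,
      ∑ v, Sum.elim (fun i => ∑ j, A i j) d v *
        (fromBlocks 1 (jacobi A B (s + 1)) 0 U *ᵥ Sum.elim x y) v ^ 2 =
      ∑ i, (∑ j, A i j) * ((x + jacobi A B (s + 1) *ᵥ y) i) ^ 2 + ∑ v, d v * (U *ᵥ y) v ^ 2 := by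
    intro x y
    rw [fromBlocks_mulVec, Fintype.sum_sum_type]
    simp
  have hX : ∀ z : F → ℝ, 0 ≤ ∑ i, (∑ j, A i j) * z i ^ 2 := fun z =>
    Finset.sum_nonneg fun i _ => mul_nonneg (hA.row_pos i).le (sq_nonneg _)
  have hS0 : ∀ y : C → ℝ, 0 ≤ y ⬝ᵥ (D - Bᵀ * A⁻¹ * B) *ᵥ y :=
    h.schur.2.posDef.posSemidef.quad_nonneg
  have hγ : (0 : ℝ) ≤ (1 + (1 / 2) ^ s) ^ 2 := by positivity
  refine ⟨?_, ?_, ?_, ?_, ?_, ?_⟩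
  · rintro (i | i)
    · simp
    · simpa using hU.unit i
  · rintro (i | i) (j | j) hij
    · left
      by_contra hne
      exact hij (by simpa using one_apply_ne (by simpa using hne))
    · right; simp
    · simp at hij
    · rcases hU.level i j (by simpa using hij) with h | h
      · left; rw [h]
      · right; simpa using h
  · rintro (i | i)
    · simp
    · simpa using hU.level_lt i
  · have hsub : {p : (F ⊕ C) × (F ⊕ C) | p.1 ≠ p.2 ∧
        fromBlocks 1 (jacobi A B (s + 1)) 0 U p.1 p.2 ≠ 0} ⊆
        Prod.map Sum.inl Sum.inr '' {p : F × C | jacobi A B (s + 1) p.1 p.2 ≠ 0} ∪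
        Prod.map Sum.inr Sum.inr '' {p : C × C | p.1 ≠ p.2 ∧ U p.1 p.2 ≠ 0} := by
      rintro ⟨i | i, j | j⟩ ⟨h1, h2⟩
      · exact absurd (by simpa using one_apply_ne (by simpa using h1)) h2
      · exact Or.inl ⟨(i, j), by simpa using h2, rfl⟩
      · simp at h2
      · exact Or.inr ⟨(i, j), ⟨by simpa using h1, by simpa using h2⟩, rfl⟩
    have h1 := (Set.ncard_le_ncard hsub (Set.toFinite _)).trans (Set.ncard_union_le _ _)
    have h2 := h1.trans (add_le_add (Set.ncard_image_le (Set.toFinite _))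
      (Set.ncard_image_le (Set.toFinite _)))
    have h3 : {p : F × C | jacobi A B (s + 1) p.1 p.2 ≠ 0}.ncard ≤
        Fintype.card F * (m + 1) ^ (s + 1) :=
      ncard_le_of_row_ncard_le fun i => (Nat.le_succ _).trans (jacobi_row_ncard hm (s + 1) i)
    have h4 := hU.sparse
    have h5 := (Nat.cast_le (α := ℝ)).2 (h2.trans (add_le_add_left h3 _))
    push_cast at h5 ⊢
    linarith
  · intro z
    obtain ⟨x, y, rfl⟩ : ∃ x y, z = Sum.elim x y := ⟨_, _, (Sum.elim_comp_inl_inr z).symm⟩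
    rw [hsum]
    have h1 := (hA.block_elimination h s x y).1
    have h2 := hU.upper y
    have h3 := mul_le_mul_of_nonneg_left h1 (zero_le_one.trans hc)
    have h4 := le_mul_of_one_le_left (hX (x + jacobi A B (s + 1) *ᵥ y)) hc
    linarith
  · intro z
    obtain ⟨x, y, rfl⟩ : ∃ x y, z = Sum.elim x y := ⟨_, _, (Sum.elim_comp_inl_inr z).symm⟩
    rw [hsum, mul_assoc]
    refine (hA.block_elimination h s x y).2.trans (mul_le_mul_of_nonneg_left ?_ hγ)
    have h2 := hU.lower y
    have h4 := le_mul_of_one_le_left (hX (x + jacobi A B (s + 1) *ᵥ y)) hc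
    linarith

theorem StronglyDominant.of_subset {V : Type*} [Fintype V] [DecidableEq V] {N : Matrix V V ℝ}
    (hN : IsSDDMOn N) {F : Finset V} (hF : ∀ i ∈ F, 5 * ∑ j ∈ F.erase i, |N i j| ≤ N i i) :
    StronglyDominant (N.submatrix (Subtype.val : F → V) Subtype.val) where
  symm := by rw [transpose_submatrix, hN.symm]
  off_nonpos i j h := hN.off_nonpos _ _ (Subtype.val_injective.ne h)
  diag_pos i := hN.posDef.diag_pos
  dominant i := by
    refine le_trans (le_of_eq ?_) (hF i i.2)
    congr 1
    refine Finset.sum_bij (fun j _ => j.1) ?_ ?_ ?_ ?_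
    · intro j hj
      exact Finset.mem_erase.2 ⟨Subtype.val_injective.ne (Finset.ne_of_mem_erase hj), j.2⟩
    · intro a _ b _ h
      exact Subtype.val_injective h
    · intro b hb
      exact ⟨⟨b, Finset.mem_of_mem_erase hb⟩, by
        simpa [Subtype.ext_iff] using Finset.ne_of_mem_erase hb, rfl⟩
    · intro a _
      rfl

theorem ncard_split_le {V : Type*} [Fintype V] [DecidableEq V] (N : Matrix V V ℝ) (F : Finset V)
    (i : F) :
    {j : F | j ≠ i ∧ N i j ≠ 0}.ncard + {j : {v // v ∉ F} | N i j ≠ 0}.ncard ≤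
      {j | j ≠ i.1 ∧ N i j ≠ 0}.ncard := by
  rw [← Set.ncard_image_of_injective {j : F | j ≠ i ∧ N i j ≠ 0} Subtype.val_injective,
    ← Set.ncard_image_of_injective {j : {v // v ∉ F} | N i j ≠ 0} Subtype.val_injective,
    ← Set.ncard_union_eq _ (Set.toFinite _) (Set.toFinite _)]
  · refine Set.ncard_le_ncard ?_ (Set.toFinite _)
    rintro _ (⟨j, hj, rfl⟩ | ⟨j, hj, rfl⟩)
    · exact ⟨Subtype.val_injective.ne hj.1, hj.2⟩
    · exact ⟨fun h => j.2 (h ▸ i.2), hj⟩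
  · rw [Set.disjoint_left]
    rintro _ ⟨j, _, rfl⟩ ⟨k, _, hk⟩
    exact k.2 (hk ▸ j.2)

/-- The recursive construction of a sparse approximate factorization. -/
theorem exists_levelFactorization {q t : ℕ → ℕ} {T c : ℕ → ℝ} (hq : ∀ j, 10 ≤ q j)
    (hT0 : ∀ j, 0 ≤ T j) (hc1 : ∀ j, 1 ≤ c j)
    (hT : ∀ j, ((4 * q j ^ 2 + 1) ^ (t j + 1) : ℕ) + 9 / 10 * T (j + 1) ≤ T j)
    (hc : ∀ j, (1 + 10 / (q j : ℝ)) * ((1 + (1 / 2) ^ t j) ^ 2 * c (j + 1)) ≤ c j)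
    (n : ℕ) (j : ℕ) (V : Type) [Fintype V] [DecidableEq V] (hV : Fintype.card V = n)
    (M : Matrix V V ℝ) (hM : IsSDDMOn M) :
    ∃ (U : Matrix V V ℝ) (d : V → ℝ) (ℓ : V → ℕ) (K : ℕ),
      ((10 : ℝ) / 9) ^ K ≤ max (1 : ℝ) (10 / 9 * (n : ℝ)) ∧
      IsLevelFactorization M U d ℓ K (T j * n) (c j) := by
  induction n using Nat.strong_induction_on generalizing j V with
  | _ n ih =>
  rcases Nat.eq_zero_or_pos n with hn | hn
  · have : IsEmpty V := Fintype.card_eq_zero_iff.1 (hV.trans hn)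
    refine ⟨1, 0, 0, 0, by simp, ⟨isEmptyElim, isEmptyElim, isEmptyElim, ?_, ?_, ?_⟩⟩
    · rw [Set.eq_empty_of_isEmpty {p : V × V | _}]
      simp [hn]
    · intro x; simp [dotProduct]
    · intro x; simp [dotProduct]
  obtain ⟨N, hN, hNcard, hMN⟩ := hM.exists_sparse (hq j)
  have hqj := hq j
  obtain ⟨F, hFcard, hFdeg, hFdom⟩ := hN.exists_dominant_subset (m := 2 * q j ^ 2)
    (by positivity) (by rw [mul_left_comm]; exact hNcard)
  rw [hV] at hFcard
  set e : F ⊕ {v // v ∉ F} ≃ V := Equiv.sumCompl (· ∈ F) with he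
  set A : Matrix F F ℝ := N.submatrix Subtype.val Subtype.val with hAdef
  set B : Matrix F {v // v ∉ F} ℝ := N.submatrix Subtype.val Subtype.val with hBdef
  set D : Matrix {v // v ∉ F} {v // v ∉ F} ℝ := N.submatrix Subtype.val Subtype.val with hDdef
  have hblocks : N.submatrix e e = fromBlocks A B Bᵀ D := by
    ext (i | i) (k | k)
    · rfl
    · rfl
    · exact apply_comm_of_transpose_eq hN.symm _ _
    · rfl
  have hNe : IsSDDMOn (fromBlocks A B Bᵀ D) := hblocks ▸ hN.submatrix e
  have hA : StronglyDominant A := .of_subset hN hFdom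
  have hCcard : Fintype.card {v // v ∉ F} + F.card = n := by
    rw [Fintype.card_subtype_compl, hV, Fintype.card_coe]
    have := F.card_le_univ
    omega
  -- The recursion takes the exact Schur complement, which need not be sparse; it is sparsified anew
  -- at step `j + 1`.
  obtain ⟨U, d, ℓ, K, hK, hU⟩ := ih (Fintype.card {v // v ∉ F}) (by omega) (j + 1)
    {v // v ∉ F} rfl _ hNe.schur.2
  have hext := IsLevelFactorization.extend hNe hA
    (m := 4 * q j ^ 2) (fun i => (ncard_split_le N F i).trans ((hFdeg i i.2).trans (by omega)))
    (t j) (hc1 _) hU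
  rw [← hblocks] at hext
  have hfin := hext.of_submatrix.of_approx (a := 1 + 10 / (q j : ℝ))
    hN.posDef.posSemidef.quad_nonneg
    (mul_nonneg (by positivity) (zero_le_one.trans (hc1 _)))
    (le_add_of_nonneg_right (by positivity)) hMN
  have hn1 : (1 : ℝ) ≤ n := by exact_mod_cast hn
  have hC9 : (Fintype.card {v // v ∉ F} : ℝ) ≤ 9 / 10 * n := by
    have h1 : (Fintype.card {v // v ∉ F} : ℝ) + F.card = n := by exact_mod_cast hCcard
    have h2 : (n : ℝ) ≤ 10 * F.card := by exact_mod_cast hFcard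
    linarith
  have hFn : (F.card : ℝ) ≤ n := by exact_mod_cast (by omega : F.card ≤ n)
  have hM0 := hM.posDef.posSemidef.quad_nonneg
  refine ⟨_, _, _, K + 1, ?_, ⟨hfin.unit, hfin.level, hfin.level_lt, hfin.sparse.trans ?_,
    fun x => (hfin.upper x).trans (mul_le_mul_of_nonneg_right (hc j) (hM0 x)), fun x => ?_⟩⟩
  · rw [pow_succ]
    refine le_trans ?_ (le_max_right _ _)
    have : max 1 (10 / 9 * (Fintype.card {v // v ∉ F} : ℝ)) ≤ n := max_le hn1 (by linarith)
    linarith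
  · rw [Fintype.card_coe]
    have h1 := mul_le_mul_of_nonneg_right hFn
      (Nat.cast_nonneg (α := ℝ) ((4 * q j ^ 2 + 1) ^ (t j + 1)))
    have h2 := mul_le_mul_of_nonneg_left hC9 (hT0 (j + 1))
    have h3 := mul_le_mul_of_nonneg_right (hT j) (zero_le_one.trans hn1)
    linarith
  · refine (hfin.lower x).trans (mul_le_mul_of_nonneg_right (hc j) ?_)
    have h1 := (hM0 x).trans (hfin.lower x)
    have h2 : (0 : ℝ) < (1 + 10 / (q j : ℝ)) * ((1 + (1 / 2) ^ t j) ^ 2 * c (j + 1)) :=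
      mul_pos (by positivity) (mul_pos (by positivity) (zero_lt_one.trans_le (hc1 _)))
    exact nonneg_of_mul_nonneg_right h1 h2

end LevelFactorization

/-! ### Choice of accuracies with summable error and linear total sparsity. -/

section Parameters

open Filter

/-- A squared logarithm grows more slowly than a linear function. -/
theorem exists_bound_exp_log_sq {a r : ℝ} (hr : 1 < r) :
    ∃ B : ℝ, ∀ j : ℕ, Real.exp (a * Real.log ((j : ℝ) + 2) ^ 2) ≤ B * r ^ j := by
  have hlr : 0 < Real.log r := Real.log_pos hr
  have h1 : (fun x : ℝ => a * Real.log x ^ 2) =o[atTop] (id : ℝ → ℝ) :=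
    (Real.isLittleO_pow_log_id_atTop (n := 2)).const_mul_left a
  have h2 := h1.def hlr
  have h3 : Tendsto (fun j : ℕ => (j : ℝ) + 2) atTop atTop :=
    tendsto_natCast_atTop_atTop.atTop_add tendsto_const_nhds
  have h4 : ∀ᶠ j : ℕ in atTop,
      Real.exp (a * Real.log ((j : ℝ) + 2) ^ 2) / r ^ j ≤ r ^ 2 := by
    filter_upwards [h3.eventually h2] with j hj
    have hj0 : (0 : ℝ) ≤ (j : ℝ) + 2 := by positivity
    rw [div_le_iff₀ (by positivity), ← pow_add,
      ← Real.exp_log (show (0 : ℝ) < r ^ (2 + j) by positivity), Real.log_pow]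
    refine Real.exp_le_exp.2 ?_
    have := (le_abs_self _).trans hj
    simp only [id, Real.norm_eq_abs, abs_of_nonneg hj0] at this
    push_cast
    linarith
  obtain ⟨B, hB⟩ := (isBoundedUnder_of_eventually_le h4).bddAbove_range
  refine ⟨B, fun j => ?_⟩
  have := hB ⟨j, rfl⟩
  rwa [div_le_iff₀ (by positivity)] at this

/-- The sparsification parameter of the `j`-th elimination step. -/
def sparsityParam (j : ℕ) : ℕ := 20 * ((j + 1) * (j + 2))

/-- The number of Jacobi iterations in the `j`-th elimination step. -/
def iterationParam (j : ℕ) : ℕ := Nat.clog 2 (4 * ((j + 1) * (j + 2)))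

/-- The base is polynomial in `j`, at most `(j + 2)^15`, and the exponent is at most `9 log (j +
2)`; `135 = 15 * 9`. -/
theorem rowBound_le (j : ℕ) :
    (((4 * sparsityParam j ^ 2 + 1) ^ (iterationParam j + 1) : ℕ) : ℝ) ≤
      Real.exp (135 * Real.log ((j : ℝ) + 2) ^ 2) := by
  set y := Real.log ((j : ℝ) + 2) with hy
  have hj : (2 : ℝ) ≤ (j : ℝ) + 2 := by linarith [Nat.cast_nonneg (α := ℝ) j]
  have hly : Real.log 2 ≤ y := Real.log_le_log (by norm_num) hj
  have hl2 : 0.6931 < Real.log 2 := by linarith [Real.log_two_gt_d9]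
  have hbase : ((4 * sparsityParam j ^ 2 + 1 : ℕ) : ℝ) ≤ Real.exp (15 * y) := by
    have h1 : Real.exp (15 * y) = ((j : ℝ) + 2) ^ 15 := by
      rw [hy, mul_comm, Real.exp_mul, Real.exp_log (by linarith)]
      norm_cast
    have h2 : (2 : ℝ) ^ 11 ≤ ((j : ℝ) + 2) ^ 11 := pow_le_pow_left₀ (by norm_num) hj 11
    have h4 : (1 : ℝ) ≤ ((j : ℝ) + 2) ^ 4 := one_le_pow₀ (by linarith)
    have h3 : ((j : ℝ) + 1) * (j + 2) ≤ ((j : ℝ) + 2) ^ 2 := by nlinarith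
    have h5 : (((j : ℝ) + 1) * (j + 2)) ^ 2 ≤ ((j : ℝ) + 2) ^ 4 := by
      calc (((j : ℝ) + 1) * (j + 2)) ^ 2 ≤ (((j : ℝ) + 2) ^ 2) ^ 2 :=
            pow_le_pow_left₀ (by positivity) h3 2
        _ = _ := by ring
    rw [h1, show ((j : ℝ) + 2) ^ 15 = ((j : ℝ) + 2) ^ 11 * ((j : ℝ) + 2) ^ 4 by ring]
    have h6 := mul_le_mul_of_nonneg_right h2 (zero_le_one.trans h4)
    have e : ((4 * sparsityParam j ^ 2 + 1 : ℕ) : ℝ) = 1600 * (((j : ℝ) + 1) * (j + 2)) ^ 2 + 1 := by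
      simp only [sparsityParam]; push_cast; ring
    rw [e]
    norm_num at h6
    linarith
  have hexp : ((iterationParam j + 1 : ℕ) : ℝ) ≤ 9 * y := by
    have hN : 1 < 4 * ((j + 1) * (j + 2)) := by nlinarith
    have h1 := Nat.pow_pred_clog_lt_self (b := 2) (by norm_num) hN
    have h2 : ((2 : ℝ) ^ (iterationParam j).pred) ≤ ((j : ℝ) + 2) ^ 4 := by
      have h3 : (((2 ^ (iterationParam j).pred : ℕ)) : ℝ) ≤
          ((4 * ((j + 1) * (j + 2)) : ℕ) : ℝ) := by
        exact_mod_cast h1.le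
      push_cast at h3
      refine h3.trans ?_
      have h4 : (2 : ℝ) ^ 2 ≤ ((j : ℝ) + 2) ^ 2 := pow_le_pow_left₀ (by norm_num) hj 2
      nlinarith
    have h3 := Real.log_le_log (by positivity) h2
    rw [Real.log_pow, Real.log_pow, ← hy] at h3
    have h4 : ((iterationParam j : ℕ) : ℝ) ≤ ((iterationParam j).pred : ℕ) + 1 := by
      exact_mod_cast (by rw [Nat.pred_eq_sub_one]; omega : iterationParam j ≤ (iterationParam j).pred + 1)
    have h5 : (((iterationParam j).pred : ℕ) : ℝ) ≤ 4 * y / Real.log 2 := by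
      rw [le_div_iff₀ (by linarith)]; exact_mod_cast h3
    have h6 : 4 * y / Real.log 2 ≤ 4 * y / 0.6931 :=
      div_le_div_of_nonneg_left (by linarith) (by norm_num) hl2.le
    have h7 : (2 : ℝ) ≤ 2 * y / 0.6931 := by rw [le_div_iff₀ (by norm_num)]; linarith
    push_cast
    have h8 : 4 * y / 0.6931 + 2 * y / 0.6931 ≤ 9 * y := by
      rw [← add_div, div_le_iff₀ (by norm_num)]; linarith
    linarith
  have hy0 : 0 ≤ y := by linarith
  rw [Nat.cast_pow]
  refine (pow_le_pow_left₀ (Nat.cast_nonneg _) hbase _).trans ?_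
  rw [← Real.exp_nat_mul]
  refine Real.exp_le_exp.2 ?_
  nlinarith [mul_le_mul_of_nonneg_right hexp hy0]

/-- With `N = (j + 1)(j + 2)`, sparsification and Jacobi iteration each lose at most `exp (1 /
(2N))`, and `1 / N = 1 / (j + 1) - 1 / (j + 2)` telescopes. -/
theorem levelError_le (j : ℕ) :
    (1 + 10 / (sparsityParam j : ℝ)) * ((1 + (1 / 2) ^ iterationParam j) ^ 2 *
      Real.exp (1 / ((j + 1 : ℕ) + 1 : ℝ))) ≤ Real.exp (1 / ((j : ℝ) + 1)) := by
  set N : ℝ := ((j : ℝ) + 1) * (j + 2) with hN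
  have hN0 : 0 < N := by positivity
  have h1 : 1 + 10 / (sparsityParam j : ℝ) ≤ Real.exp (1 / (2 * N)) := by
    have : 10 / (sparsityParam j : ℝ) = 1 / (2 * N) := by
      simp only [sparsityParam]; push_cast; rw [hN]; field_simp; norm_num
    rw [this, add_comm]
    exact Real.add_one_le_exp _
  have h2 : (1 + (1 / 2 : ℝ) ^ iterationParam j) ^ 2 ≤ Real.exp (1 / (2 * N)) := by
    have h3 : 4 * N ≤ (2 : ℝ) ^ iterationParam j := by
      have := Nat.le_pow_clog (b := 2) (by norm_num) (4 * ((j + 1) * (j + 2)))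
      have h4 : ((4 * ((j + 1) * (j + 2)) : ℕ) : ℝ) ≤ ((2 ^ iterationParam j : ℕ) : ℝ) := by
        exact_mod_cast this
      push_cast at h4
      exact h4
    have h4 : (1 / 2 : ℝ) ^ iterationParam j ≤ 1 / (4 * N) := by
      rw [one_div_pow]
      exact one_div_le_one_div_of_le (by positivity) h3
    have h5 : 1 + (1 / 2 : ℝ) ^ iterationParam j ≤ Real.exp (1 / (4 * N)) := by
      rw [add_comm]
      exact (add_le_add_left h4 1).trans (Real.add_one_le_exp _)
    refine (pow_le_pow_left₀ (by positivity) h5 2).trans (le_of_eq ?_)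
    rw [← Real.exp_nat_mul]
    congr 1
    field_simp
    norm_num
  calc _ ≤ Real.exp (1 / (2 * N)) * (Real.exp (1 / (2 * N)) *
        Real.exp (1 / ((j + 1 : ℕ) + 1 : ℝ))) := by gcongr
    _ = Real.exp (1 / ((j : ℝ) + 1)) := by
      rw [← Real.exp_add, ← Real.exp_add]
      congr 1
      push_cast
      rw [hN]
      field_simp
      ring

/-- Sparse approximate factorizations with constants independent of the matrix. -/
theorem exists_uniform_levelFactorization :
    ∃ T : ℝ, 0 ≤ T ∧ ∀ (n : ℕ) (M : Matrix (Fin n) (Fin n) ℝ), IsSDDM M →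
      ∃ (U : Matrix (Fin n) (Fin n) ℝ) (d : Fin n → ℝ) (ℓ : Fin n → ℕ) (K : ℕ),
        ((10 : ℝ) / 9) ^ K ≤ max (1 : ℝ) (10 / 9 * (n : ℝ)) ∧
        IsLevelFactorization M U d ℓ K (T * n) (Real.exp 1) := by
  obtain ⟨B, hB⟩ := exists_bound_exp_log_sq (a := 135) (r := 21 / 20) (by norm_num)
  have hB0 : 0 ≤ B := by
    have := (Real.exp_pos _).le.trans (hB 0)
    simpa using this
  -- `0.055 = 1 - 9/10 * 21/20`: the row bound grows like `(21/20)^j` while the sizes shrink by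
  -- `9/10`.
  refine ⟨B / 0.055, by positivity, fun n M hM => ?_⟩
  have h := exists_levelFactorization (q := sparsityParam) (t := iterationParam)
    (T := fun j => B * (21 / 20) ^ j / 0.055) (c := fun j => Real.exp (1 / ((j : ℝ) + 1)))
    (fun j => by simp only [sparsityParam]; nlinarith)
    (fun j => by positivity) (fun j => Real.one_le_exp (by positivity))
    (fun j => by
      refine (add_le_add_left ((rowBound_le j).trans (hB j)) _).trans (le_of_eq ?_)
      rw [pow_succ]; ring)
    levelError_le n 0 (Fin n) (Fintype.card_fin n) M hM.isSDDMOn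
  simpa using h

end Parameters

/-! ### Circuits for substitution level by level. -/

section Circuits

namespace ArithCircuit

/-- The depth of a wire; inputs have depth `0`. -/
def wireDepth {ι : Type} {s : ℕ} (c : ArithCircuit ι s) (w : ι ⊕ Fin s) : ℕ :=
  Sum.elim (fun _ => 0) c.gateDepth w

/-- The wires of a circuit, as wires of the circuit with one more gate. -/
def liftWire {ι : Type} {s : ℕ} (w : ι ⊕ Fin s) : ι ⊕ Fin (s + 1) := w.map id Fin.castSucc

variable {ι : Type} {s : ℕ}

theorem value_snoc_lift (c : ArithCircuit ι s) (op : ArithOp) (l r w : ι ⊕ Fin s) (x : ι → ℝ) :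
    (snoc c op l r).value x (liftWire w) = c.value x w := by
  rcases w with w | w
  · rfl
  · simp [liftWire, value, gateValue]

theorem value_snoc_last (c : ArithCircuit ι s) (op : ArithOp) (l r : ι ⊕ Fin s) (x : ι → ℝ) :
    (snoc c op l r).value x (.inr (Fin.last s)) = op.apply (c.value x l) (c.value x r) := by
  simp [value, gateValue]

theorem wireDepth_snoc_lift (c : ArithCircuit ι s) (op : ArithOp) (l r w : ι ⊕ Fin s) :
    (snoc c op l r).wireDepth (liftWire w) = c.wireDepth w := by
  rcases w with w | w
  · rfl
  · simp [liftWire, wireDepth, gateDepth]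

theorem wireDepth_snoc_last (c : ArithCircuit ι s) (op : ArithOp) (l r : ι ⊕ Fin s) :
    (snoc c op l r).wireDepth (.inr (Fin.last s)) = max (c.wireDepth l) (c.wireDepth r) + 1 := by
  simp [wireDepth, gateDepth]

theorem depth_snoc_le (c : ArithCircuit ι s) (op : ArithOp) (l r : ι ⊕ Fin s) :
    (snoc c op l r).depth ≤ max c.depth (max (c.wireDepth l) (c.wireDepth r) + 1) := by
  refine Finset.sup_le fun i _ => ?_
  refine Fin.lastCases ?_ (fun i => ?_) i
  · exact le_max_of_le_right (wireDepth_snoc_last c op l r).le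
  · refine le_max_of_le_left ?_
    have : (snoc c op l r).gateDepth i.castSucc = c.gateDepth i := by simp [gateDepth]
    rw [this]
    exact Finset.le_sup (f := c.gateDepth) (Finset.mem_univ i)

end ArithCircuit

variable {ι Θ : Type}

/-- A circuit that never divides by zero on the inputs of the family `inp`. -/
structure SafeCircuit (inp : Θ → ι → ℝ) where
  size : ℕ
  circuit : ArithCircuit ι size
  safe : ∀ θ, circuit.DivSafe (inp θ)

namespace SafeCircuit

variable {inp : Θ → ι → ℝ}

/-- Some wire of depth at most `d` carries the value `g`. -/
def Has (c : SafeCircuit inp) (g : Θ → ℝ) (d : ℕ) : Prop :=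
  ∃ w, (∀ θ, c.circuit.value (inp θ) w = g θ) ∧ c.circuit.wireDepth w ≤ d

/-- `c'` carries all the values of `c` and has at most `k` more gates, of depth at most `D`. -/
structure Extends (c c' : SafeCircuit inp) (k D : ℕ) : Prop where
  has : ∀ g d, c.Has g d → c'.Has g d
  size : c'.size ≤ c.size + k
  depth : c'.circuit.depth ≤ max c.circuit.depth D

theorem Has.mono {c : SafeCircuit inp} {g : Θ → ℝ} {d d' : ℕ} (h : c.Has g d) (hd : d ≤ d') :
    c.Has g d' :=
  h.imp fun _ hw => ⟨hw.1, hw.2.trans hd⟩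

theorem Extends.refl (c : SafeCircuit inp) (D : ℕ) : c.Extends c 0 D :=
  ⟨fun _ _ h => h, le_rfl, le_max_left _ _⟩

theorem Extends.trans {c c' c'' : SafeCircuit inp} {k k' D D' : ℕ} (h : c.Extends c' k D)
    (h' : c'.Extends c'' k' D') (hD : D ≤ D') : c.Extends c'' (k + k') D' :=
  ⟨fun g d hg => h'.has g d (h.has g d hg), by have := h.size; have := h'.size; omega,
    by have := h.depth; have := h'.depth; omega⟩

theorem has_input (c : SafeCircuit inp) (i : ι) (d : ℕ) : c.Has (fun θ => inp θ i) d :=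
  ⟨.inl i, fun _ => rfl, Nat.zero_le _⟩

theorem exists_gate (c : SafeCircuit inp) {op : ArithOp} (hop : op ≠ .div) {g₁ g₂ : Θ → ℝ}
    {d : ℕ} (h₁ : c.Has g₁ d) (h₂ : c.Has g₂ d) :
    ∃ c' : SafeCircuit inp, c.Extends c' 1 (d + 1) ∧
      c'.Has (fun θ => op.apply (g₁ θ) (g₂ θ)) (d + 1) := by
  obtain ⟨l, hl, hld⟩ := h₁
  obtain ⟨r, hr, hrd⟩ := h₂
  refine ⟨⟨c.size + 1, .snoc c.circuit op l r, fun θ => ⟨c.safe θ, fun h => absurd h hop⟩⟩,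
    ⟨?_, le_rfl, ?_⟩, ?_⟩
  · rintro g d ⟨w, hw, hwd⟩
    exact ⟨ArithCircuit.liftWire w, fun θ => by rw [ArithCircuit.value_snoc_lift, hw],
      by rwa [ArithCircuit.wireDepth_snoc_lift]⟩
  · refine (ArithCircuit.depth_snoc_le _ _ _ _).trans ?_
    omega
  · refine ⟨.inr (Fin.last _), fun θ => by rw [ArithCircuit.value_snoc_last, hl, hr], ?_⟩
    rw [ArithCircuit.wireDepth_snoc_last]
    omega

/-- Parallel composition: each value is built from wires of `c` alone, so the sizes add while the
depth bound `D` is shared. The arbitrary `c'` allows for gates already added for other indices. -/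
theorem exists_forall {α : Type*} [DecidableEq α] (c : SafeCircuit inp) (S : Finset α)
    (g : α → Θ → ℝ) (k : α → ℕ) (d D : ℕ)
    (h : ∀ a ∈ S, ∀ c' : SafeCircuit inp, (∀ g d, c.Has g d → c'.Has g d) →
      ∃ c'' : SafeCircuit inp, c'.Extends c'' (k a) D ∧ c''.Has (g a) d) :
    ∃ c' : SafeCircuit inp, c.Extends c' (∑ a ∈ S, k a) D ∧ ∀ a ∈ S, c'.Has (g a) d := by
  induction S using Finset.induction_on with
  | empty => exact ⟨c, by simpa using Extends.refl c D, by simp⟩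
  | insert a S ha ih =>
    obtain ⟨c₁, h₁, hS⟩ := ih fun b hb => h b (Finset.mem_insert_of_mem hb)
    obtain ⟨c₂, h₂, hg⟩ := h a (Finset.mem_insert_self _ _) c₁ h₁.has
    refine ⟨c₂, ?_, ?_⟩
    · rw [Finset.sum_insert ha, add_comm]
      exact h₁.trans h₂ le_rfl
    · intro b hb
      rcases Finset.mem_insert.1 hb with rfl | hb
      · exact hg
      · exact h₂.has _ _ (hS b hb)

/-- A sum of at most `2 ^ p` terms costs depth `p`. -/
theorem exists_sum {α : Type*} [DecidableEq α] (c : SafeCircuit inp) {S : Finset α}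
    (hS : S.Nonempty) {g : α → Θ → ℝ} {d : ℕ} (h : ∀ a ∈ S, c.Has (g a) d) {p : ℕ}
    (hp : S.card ≤ 2 ^ p) :
    ∃ c' : SafeCircuit inp, c.Extends c' (S.card - 1) (d + p) ∧
      c'.Has (fun θ => ∑ a ∈ S, g a θ) (d + p) := by
  induction p generalizing S c with
  | zero =>
    have h1 : S.card = 1 := le_antisymm (by simpa using hp) hS.card_pos
    obtain ⟨a, rfl⟩ := Finset.card_eq_one.1 h1
    exact ⟨c, by simpa using Extends.refl c d, by simpa using h a (by simp)⟩
  | succ p ih =>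
    rcases Nat.lt_or_ge S.card 2 with hlt | hge
    · have h1 : S.card = 1 := le_antisymm (by omega) hS.card_pos
      obtain ⟨a, rfl⟩ := Finset.card_eq_one.1 h1
      exact ⟨c, by simpa using Extends.refl c (d + (p + 1)),
        by simpa using (h a (by simp)).mono (Nat.le_add_right d (p + 1))⟩
    · rw [pow_succ] at hp
      obtain ⟨S₁, hsub, hc₁⟩ := Finset.exists_subset_card_eq (s := S) (n := S.card / 2) (by omega)
      have hc₂ : (S \ S₁).card = S.card - S.card / 2 := by
        rw [Finset.card_sdiff_of_subset hsub, hc₁]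
      obtain ⟨c₁, e₁, g₁⟩ := ih c (S := S₁) (Finset.card_pos.1 (by omega))
        (fun a ha => h a (hsub ha)) (by omega)
      obtain ⟨c₂, e₂, g₂⟩ := ih c₁ (S := S \ S₁) (Finset.card_pos.1 (by omega))
        (fun a ha => e₁.has _ _ (h a (Finset.sdiff_subset ha))) (by omega)
      obtain ⟨c₃, e₃, g₃⟩ := c₂.exists_gate (op := .add) (by simp) (e₂.has _ _ g₁) g₂
      refine ⟨c₃, ?_, ?_⟩
      · have := (e₁.trans e₂ le_rfl).trans e₃ (Nat.le_succ _)
        have hk : S₁.card - 1 + ((S \ S₁).card - 1) + 1 = S.card - 1 := by omega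
        rwa [hk] at this
      · have : (fun θ => ArithOp.add.apply (∑ a ∈ S₁, g a θ) (∑ a ∈ S \ S₁, g a θ)) =
            fun θ => ∑ a ∈ S, g a θ := by
          funext θ
          rw [← Finset.sum_sdiff hsub]
          exact add_comm _ _
        rwa [this] at g₃

/-- One substitution `b - ∑ a, u a * x a`. -/
theorem exists_sub_sum_mul {α : Type*} [DecidableEq α] (c : SafeCircuit inp) {S : Finset α}
    (hS : S.Nonempty) {u x : α → Θ → ℝ} {b : Θ → ℝ} {d : ℕ} (hu : ∀ a ∈ S, c.Has (u a) d)
    (hx : ∀ a ∈ S, c.Has (x a) d) (hb : c.Has b d) {p : ℕ} (hp : S.card ≤ 2 ^ p) :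
    ∃ c' : SafeCircuit inp, c.Extends c' (2 * S.card) (d + (p + 2)) ∧
      c'.Has (fun θ => b θ - ∑ a ∈ S, u a θ * x a θ) (d + (p + 2)) := by
  obtain ⟨c₁, e₁, g₁⟩ := c.exists_forall S (fun a θ => u a θ * x a θ) (fun _ => 1) (d + 1) (d + 1)
    fun a ha c' hc' => c'.exists_gate (op := .mul) (by simp) (hc' _ _ (hu a ha)) (hc' _ _ (hx a ha))
  obtain ⟨c₂, e₂, g₂⟩ := c₁.exists_sum hS g₁ hp
  obtain ⟨c₃, e₃, g₃⟩ := c₂.exists_gate (op := .sub) (by simp)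
    (e₂.has _ _ (e₁.has _ _ (hb.mono (by omega)))) g₂
  have hd : d + 1 + p + 1 = d + (p + 2) := by omega
  rw [hd] at e₃ g₃
  refine ⟨c₃, ?_, g₃⟩
  have := (e₁.trans e₂ (by omega)).trans e₃ (by omega)
  -- One product per term, one addition fewer than terms, and the final subtraction.
  have hk : ∑ _a ∈ S, 1 + (S.card - 1) + 1 = 2 * S.card := by
    have := hS.card_pos
    simp only [Finset.sum_const, smul_eq_mul, mul_one]
    omega
  rwa [hk] at this

/-- The circuit without gates. -/
def empty (inp : Θ → ι → ℝ) : SafeCircuit inp := ⟨0, .nil, fun _ => trivial⟩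

end SafeCircuit

open Matrix in
/-- Substitution, level by level, in a unit triangular matrix. -/
theorem solvableIn_of_levels {n : ℕ} {A : Matrix (Fin n) (Fin n) ℝ} {ℓ : Fin n → ℕ} {K : ℕ}
    (hunit : ∀ v, A v v = 1) (hlevel : ∀ u v, A u v ≠ 0 → u = v ∨ ℓ u < ℓ v)
    (hlt : ∀ v, ℓ v < K) (hdet : IsUnit A.det) {p : ℕ} (hp : n ≤ 2 ^ p) :
    SolvableIn A (2 * {q : Fin n × Fin n | q.1 ≠ q.2 ∧ A q.1 q.2 ≠ 0}.ncard)
      (((K - 1) * (p + 2) : ℕ) : ℝ) := by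
  classical
  set inp : (Fin n → ℝ) → (Fin n × Fin n) ⊕ Fin n → ℝ :=
    fun b => Sum.elim (fun q => A q.1 q.2) b with hinp
  set S : Fin n → Finset (Fin n) := fun v => Finset.univ.filter fun u => v ≠ u ∧ A v u ≠ 0 with hS
  set sol : Fin n → (Fin n → ℝ) → ℝ := fun v b => (A⁻¹ *ᵥ b) v with hsol
  have hsolve : ∀ b, A *ᵥ (fun v => sol v b) = b := by
    intro b
    change A *ᵥ (A⁻¹ *ᵥ b) = b
    rw [mulVec_mulVec, mul_nonsing_inv _ hdet, one_mulVec]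
  have hrec : ∀ v, sol v = fun b => b v - ∑ u ∈ S v, A v u * sol u b := by
    intro v
    funext b
    have h1 := congrFun (hsolve b) v
    have h2 : ∑ u, A v u * sol u b = sol v b + ∑ u ∈ S v, A v u * sol u b := by
      rw [← Finset.add_sum_erase _ _ (Finset.mem_univ v), hunit, one_mul]
      congr 1
      symm
      refine Finset.sum_subset ?_ ?_
      · intro u hu
        exact Finset.mem_erase.2 ⟨(Finset.mem_filter.1 hu).2.1.symm, Finset.mem_univ _⟩
      · intro u hu hu'
        have : A v u = 0 := by
          by_contra hne
          exact hu' (Finset.mem_filter.2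
            ⟨Finset.mem_univ _, (Finset.ne_of_mem_erase hu).symm, hne⟩)
        rw [this, zero_mul]
    have h3 : ∑ u, A v u * sol u b = b v := h1
    linarith
  -- After `k` stages the top `k` levels are solved. The topmost has only diagonal entries, so its
  -- solution is an input and costs no depth; hence `k - 1`.
  have hstage : ∀ k, ∃ c : SafeCircuit inp,
      (SafeCircuit.empty inp).Extends c
        (∑ v ∈ Finset.univ.filter (fun v => K ≤ ℓ v + k), 2 * (S v).card)
        ((k - 1) * (p + 2)) ∧
      ∀ v, K ≤ ℓ v + k → c.Has (sol v) ((k - 1) * (p + 2)) := by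
    intro k
    induction k with
    | zero =>
      refine ⟨.empty inp, ?_, fun v hv => absurd (hlt v) (by omega)⟩
      have : Finset.univ.filter (fun v => K ≤ ℓ v + 0) = ∅ :=
        Finset.filter_eq_empty_iff.2 fun v _ => by have := hlt v; omega
      rw [this, Finset.sum_empty]
      exact .refl _ _
    | succ k ih =>
      obtain ⟨c, hc, hk⟩ := ih
      have hmono : (k - 1) * (p + 2) ≤ (k + 1 - 1) * (p + 2) :=
        Nat.mul_le_mul_right _ (by omega)
      obtain ⟨c', hc', hnew⟩ := c.exists_forall
        (Finset.univ.filter fun v => ℓ v + (k + 1) = K) sol (fun v => 2 * (S v).card)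
        ((k + 1 - 1) * (p + 2)) ((k + 1 - 1) * (p + 2)) (by
          intro v hv c' hcc'
          have hv' : ℓ v + (k + 1) = K := (Finset.mem_filter.1 hv).2
          have hb : c'.Has (fun b => b v) ((k - 1) * (p + 2)) := c'.has_input (.inr v) _
          have hSl : ∀ u ∈ S v, K ≤ ℓ u + k := by
            intro u hu
            obtain ⟨h1, h2⟩ := (Finset.mem_filter.1 hu).2
            have := (hlevel v u h2).resolve_left h1
            omega
          rcases (S v).eq_empty_or_nonempty with he | hne
          · refine ⟨c', by rw [he]; exact .refl _ _, ?_⟩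
            rw [hrec, he]
            simpa using hb.mono hmono
          · have hk1 : 1 ≤ k := by
              obtain ⟨u, hu⟩ := hne
              have := hSl u hu
              have := hlt u
              omega
            obtain ⟨c'', e, g⟩ := c'.exists_sub_sum_mul hne (u := fun u _ => A v u) (x := sol)
              (fun u _ => c'.has_input (.inl (v, u)) _)
              (fun u hu => hcc' _ _ (hk u (hSl u hu))) hb
              (((S v).card_le_univ.trans (by simp)).trans hp)
            have hd : (k - 1) * (p + 2) + (p + 2) = (k + 1 - 1) * (p + 2) := by
              obtain ⟨k', rfl⟩ := Nat.exists_eq_add_of_le' hk1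
              simp; ring
            rw [hd] at e g
            rw [hrec]
            exact ⟨c'', e, g⟩)
      refine ⟨c', ?_, fun v hv => ?_⟩
      · have e : Finset.univ.filter (fun v => K ≤ ℓ v + (k + 1)) =
            Finset.univ.filter (fun v => K ≤ ℓ v + k) ∪
              Finset.univ.filter (fun v => ℓ v + (k + 1) = K) := by
          ext v
          simp only [Finset.mem_filter, Finset.mem_univ, true_and, Finset.mem_union]
          omega
        rw [e, Finset.sum_union]
        · exact hc.trans hc' hmono
        · rw [Finset.disjoint_filter]
          intro v _ h1 h2
          omega
      · rcases Nat.lt_or_ge (ℓ v + k) K with h | h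
        · exact hnew v (Finset.mem_filter.2 ⟨Finset.mem_univ _, by omega⟩)
        · exact (hc'.has _ _ (hk v h)).mono hmono
  obtain ⟨c, hc, hsolc⟩ := hstage K
  choose out hout _ using fun v => hsolc v (Nat.le_add_left _ _)
  refine ⟨c.size, c.circuit, out, ?_, ?_, fun b => ⟨c.safe b, ?_⟩⟩
  · have h1 : c.size ≤ 2 * {q : Fin n × Fin n | q.1 ≠ q.2 ∧ A q.1 q.2 ≠ 0}.ncard := by
      refine hc.size.trans ?_
      rw [Set.ncard_eq_toFinset_card', Set.toFinset_ofPred, Finset.card_filter,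
        Fintype.sum_prod_type, Finset.filter_true_of_mem fun v _ => Nat.le_add_left _ _,
        ← Finset.mul_sum]
      simp only [SafeCircuit.empty, zero_add, hS, Finset.card_filter]
      exact le_rfl
    exact_mod_cast h1
  · have := hc.depth
    have h0 : (SafeCircuit.empty inp).circuit.depth = 0 := rfl
    rw [h0] at this
    exact_mod_cast this.trans (by simp)
  · have : (fun i => c.circuit.value (inp b) (out i)) = fun v => sol v b := by
      funext v; exact hout v b
    rw [this]
    exact hsolve b

end Circuits

/-! ### Final bounds and ordering by level. -/

section Assembly

open Matrix

theorem SolvableIn.mono {n : ℕ} {A : Matrix (Fin n) (Fin n) ℝ} {w w' d d' : ℝ}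
    (h : SolvableIn A w d) (hw : w ≤ w') (hd : d ≤ d') : SolvableIn A w' d' := by
  obtain ⟨s, c, out, h1, h2, h3⟩ := h
  exact ⟨s, c, out, h1.trans hw, h2.trans hd, h3⟩

/-- Both factors are `O(log n)`. Counting `K - 1` levels is essential at `n = 1`, where the
right-hand side vanishes. -/
theorem level_depth_le {n K : ℕ} (hK : ((10 : ℝ) / 9) ^ K ≤ max (1 : ℝ) (10 / 9 * (n : ℝ))) :
    (((K - 1) * (Nat.clog 2 n + 2) : ℕ) : ℝ) ≤ 60 * Real.log n ^ 2 := by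
  rcases Nat.eq_zero_or_pos (K - 1) with h0 | h0
  · rw [h0]; simp only [zero_mul, Nat.cast_zero]; positivity
  have hn1 : (1 : ℝ) < n := by
    by_contra hcon
    have h1 : ((10 : ℝ) / 9) ^ 2 ≤ (10 / 9) ^ K := pow_le_pow_right₀ (by norm_num) (by omega)
    have h2 : max (1 : ℝ) (10 / 9 * n) ≤ 10 / 9 := max_le (by norm_num) (by linarith)
    have := h1.trans (hK.trans h2)
    norm_num at this
  have hn2 : (2 : ℝ) ≤ n := by exact_mod_cast (by exact_mod_cast hn1 : 1 < n)
  have hlog2 : 0.6931 < Real.log 2 := by linarith [Real.log_two_gt_d9]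
  have hlogn : Real.log 2 ≤ Real.log n := Real.log_le_log (by norm_num) hn2
  have hK1 : ((K - 1 : ℕ) : ℝ) ≤ 10 * Real.log n := by
    have h1 : ((10 : ℝ) / 9) ^ (K - 1) ≤ n := by
      rw [max_eq_right (by linarith)] at hK
      obtain ⟨k, rfl⟩ : ∃ k, K = k + 1 := ⟨K - 1, by omega⟩
      rw [pow_succ] at hK
      rw [Nat.add_sub_cancel]
      linarith
    have h2 := Real.log_le_log (by positivity) h1
    rw [Real.log_pow] at h2
    have h3 := Real.one_sub_inv_le_log_of_pos (show (0 : ℝ) < 10 / 9 by norm_num)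
    have h4 : (1 : ℝ) / 10 ≤ Real.log (10 / 9) := by norm_num at h3 ⊢; linarith
    have h5 := mul_le_mul_of_nonneg_left h4 (Nat.cast_nonneg (α := ℝ) (K - 1))
    linarith
  have hp : ((Nat.clog 2 n + 2 : ℕ) : ℝ) ≤ 6 * Real.log n := by
    have h1 := Nat.pow_pred_clog_lt_self (b := 2) (by norm_num)
      (by exact_mod_cast hn1 : 1 < n)
    have h2 : ((2 : ℝ) ^ (Nat.clog 2 n).pred) ≤ n := by exact_mod_cast h1.le
    have h3 := Real.log_le_log (by positivity) h2
    rw [Real.log_pow] at h3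
    have h4 : (Nat.clog 2 n : ℝ) ≤ ((Nat.clog 2 n).pred : ℕ) + 1 := by
      exact_mod_cast (by rw [Nat.pred_eq_sub_one]; omega :
        Nat.clog 2 n ≤ (Nat.clog 2 n).pred + 1)
    have h5 : ((Nat.clog 2 n).pred : ℝ) * 0.6931 ≤ Real.log n :=
      le_trans (mul_le_mul_of_nonneg_left hlog2.le (Nat.cast_nonneg _)) h3
    push_cast
    linarith
  rw [Nat.cast_mul]
  calc ((K - 1 : ℕ) : ℝ) * ((Nat.clog 2 n + 2 : ℕ) : ℝ)
      ≤ (10 * Real.log n) * (6 * Real.log n) :=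
        mul_le_mul hK1 hp (Nat.cast_nonneg _) (by linarith)
    _ = 60 * Real.log n ^ 2 := by ring

/-- The lower bound holds with factor `3/2 * e`, below `e²` because `e > 3/2`. -/
theorem IsLevelFactorization.spectralApprox {n : ℕ} {M U : Matrix (Fin n) (Fin n) ℝ}
    {d : Fin n → ℝ} {ℓ : Fin n → ℕ} {K : ℕ} {T : ℝ} (hM : M.PosSemidef)
    (h : IsLevelFactorization M U d ℓ K T (Real.exp 1)) :
    SpectralApprox 2 (Uᵀ * diagonal d * U) M := by
  have hs : (Uᵀ * diagonal d * U)ᵀ = Uᵀ * diagonal d * U := by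
    rw [transpose_mul, transpose_mul, transpose_transpose, diagonal_transpose, Matrix.mul_assoc]
  have hq : ∀ x, x ⬝ᵥ (Uᵀ * diagonal d * U) *ᵥ x = ∑ v, d v * (U *ᵥ x) v ^ 2 := by
    intro x
    rw [← quad_diagonal, Matrix.mul_assoc, ← mulVec_mulVec, dotProduct_mulVec, vecMul_transpose,
      mulVec_mulVec]
  have he2 : Real.exp 2 = Real.exp 1 * Real.exp 1 := by rw [← Real.exp_add]; norm_num
  have he : (2.7 : ℝ) < Real.exp 1 := by linarith [Real.exp_one_gt_d9]
  have hMx := hM.quad_nonneg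
  constructor
  · refine posSemidef_of_quad (by rw [transpose_sub, transpose_smul, hM.transpose_eq, hs])
      fun x => ?_
    rw [sub_mulVec, dotProduct_sub, smul_mulVec, dotProduct_smul, hq, smul_eq_mul, he2]
    have h1 := h.upper x
    have h2 := mul_nonneg (Real.exp_pos 1).le (hMx x)
    nlinarith
  · refine posSemidef_of_quad (by rw [transpose_sub, transpose_smul, hM.transpose_eq, hs])
      fun x => ?_
    rw [sub_mulVec, dotProduct_sub, smul_mulVec, dotProduct_smul, hq, smul_eq_mul, Real.exp_neg,
      he2, sub_nonneg, inv_mul_le_iff₀ (by positivity)]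
    have h1 := h.lower x
    have h2 : 0 ≤ ∑ v, d v * (U *ᵥ x) v ^ 2 := by
      have h3 := (hMx x).trans h1
      have h4 := nonneg_of_mul_nonneg_right h3 (Real.exp_pos 1)
      linarith
    have h5 := mul_nonneg (Real.exp_pos 1).le h2
    nlinarith

theorem IsLevelFactorization.numNonzero_le {n : ℕ} {M U : Matrix (Fin n) (Fin n) ℝ}
    {d : Fin n → ℝ} {ℓ : Fin n → ℕ} {K : ℕ} {T c : ℝ} (h : IsLevelFactorization M U d ℓ K T c) :
    (numNonzero U : ℝ) ≤ n + T := by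
  have hsub : {p : Fin n × Fin n | U p.1 p.2 ≠ 0} ⊆
      (fun i => (i, i)) '' (Set.univ : Set (Fin n)) ∪
        {p : Fin n × Fin n | p.1 ≠ p.2 ∧ U p.1 p.2 ≠ 0} := by
    rintro ⟨i, j⟩ hij
    by_cases he : i = j
    · exact Or.inl ⟨i, trivial, by rw [he]⟩
    · exact Or.inr ⟨he, hij⟩
  have h1 := (Set.ncard_le_ncard hsub (Set.toFinite _)).trans (Set.ncard_union_le _ _)
  have h2 : ((fun i => (i, i)) '' (Set.univ : Set (Fin n))).ncard ≤ n :=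
    (Set.ncard_image_le (Set.toFinite _)).trans (by simp [Set.ncard_univ])
  have h3 : (numNonzero U : ℝ) ≤
      ((n + {p : Fin n × Fin n | p.1 ≠ p.2 ∧ U p.1 p.2 ≠ 0}.ncard : ℕ) : ℝ) :=
    Nat.cast_le.2 (h1.trans (add_le_add_left h2 _))
  push_cast at h3
  linarith [h.sparse]

end Assembly

/-- The rows and columns of `M` are simultaneously reordered by `σ`; `U *ᵥ x = b` is a back
solve and `Uᵀ *ᵥ x = b` a forward solve. -/
theorem mainTheorem1 :
    ∃ C : ℝ, ∀ (n : ℕ) (M : Matrix (Fin n) (Fin n) ℝ), IsSDDM M →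
      ∃ (σ : Equiv.Perm (Fin n)) (D U : Matrix (Fin n) (Fin n) ℝ),
        D.IsDiag ∧
        U.BlockTriangular id ∧
        (numNonzero U : ℝ) ≤ C * n ∧
        SpectralApprox 2 (Uᵀ * D * U) (M.submatrix σ σ) ∧
        SolvableIn U (C * n) (C * Real.log n ^ 2) ∧
        SolvableIn Uᵀ (C * n) (C * Real.log n ^ 2) := by
  obtain ⟨T, hT, h⟩ := exists_uniform_levelFactorization
  refine ⟨2 * T + 60, fun n M hM => ?_⟩
  obtain ⟨U, d, ℓ, K, hK, hU⟩ := h n M hM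
  -- Entries of `U` lead to strictly higher levels, so sorting by level makes it upper triangular.
  set σ := Tuple.sort ℓ with hσ
  have hmono : Monotone (ℓ ∘ σ) := Tuple.monotone_sort ℓ
  have hF : IsLevelFactorization (M.submatrix σ σ) (U.submatrix σ σ) (d ∘ σ) (ℓ ∘ σ) K
      (T * n) (Real.exp 1) :=
    IsLevelFactorization.of_submatrix (M := M.submatrix σ σ) σ.symm (by simpa using hU)
  have htri : (U.submatrix σ σ).BlockTriangular id := by
    intro i j hij
    by_contra hne
    rcases hF.level i j hne with h | h
    · exact hij.ne h.symm
    · exact absurd (hmono (le_of_lt hij)) (not_le.2 h)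
  have hdet : (U.submatrix σ σ).det = 1 := by
    rw [Matrix.det_of_isUpperTriangular htri]
    exact Finset.prod_eq_one fun i _ => hF.unit i
  have hp : n ≤ 2 ^ Nat.clog 2 n := Nat.le_pow_clog (by norm_num) n
  have hn : (0 : ℝ) ≤ n := Nat.cast_nonneg n
  have hTn : 0 ≤ T * n := mul_nonneg hT hn
  have hdepth : (((K - 1) * (Nat.clog 2 n + 2) : ℕ) : ℝ) ≤ (2 * T + 60) * Real.log n ^ 2 :=
    (level_depth_le hK).trans (mul_le_mul_of_nonneg_right (by linarith) (sq_nonneg _))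
  refine ⟨σ, Matrix.diagonal (d ∘ σ), U.submatrix σ σ, Matrix.isDiag_diagonal _, htri, ?_, ?_, ?_,
    ?_⟩
  · linarith [hF.numNonzero_le]
  · exact hF.spectralApprox (hM.isSDDMOn.posDef.posSemidef.submatrix σ)
  · refine (solvableIn_of_levels hF.unit hF.level hF.level_lt (by rw [hdet]; exact isUnit_one)
      hp).mono ?_ hdepth
    linarith [hF.sparse]
  -- Transposition reverses all edges, so the levels are counted from the other end.
  · refine (solvableIn_of_levels (A := (U.submatrix σ σ)ᵀ) (ℓ := fun v => K - 1 - (ℓ ∘ σ) v)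
      (K := K) hF.unit ?_ ?_ (by rw [Matrix.det_transpose, hdet]; exact isUnit_one) hp).mono ?_
      hdepth
    · intro u v huv
      rcases hF.level v u huv with h | h
      · exact Or.inl h.symm
      · have := hF.level_lt u
        right
        omega
    · intro v
      have := hF.level_lt v
      omega
    · have hswap : {q : Fin n × Fin n | q.1 ≠ q.2 ∧ (U.submatrix σ σ)ᵀ q.1 q.2 ≠ 0}.ncard ≤
          {q : Fin n × Fin n | q.1 ≠ q.2 ∧ (U.submatrix σ σ) q.1 q.2 ≠ 0}.ncard := by
        rw [← Set.ncard_image_of_injective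
          {q : Fin n × Fin n | q.1 ≠ q.2 ∧ (U.submatrix σ σ) q.1 q.2 ≠ 0} Prod.swap_injective]
        refine Set.ncard_le_ncard ?_ (Set.toFinite _)
        rintro ⟨i, j⟩ ⟨h1, h2⟩
        exact ⟨(j, i), ⟨h1.symm, h2⟩, rfl⟩
      have := (Nat.cast_le (α := ℝ)).2 hswap
      linarith [hF.sparse]
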